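/- Let $K$ be a field of characteristic zero and let $A$ be the algebra of all matrices $\begin{pmatrix} d & a & c\\ 0 & g & b\\ 0 & 0 & d\end{pmatrix}$ with $a,b,c,d,g\in K$, with the involution given by reflection in the secondary diagonal, $$\begin{pmatrix} d & a & c\\ 0 & g & b\\ 0 & 0 & d\end{pmatrix}^{*}=\begin{pmatrix} d & b & c\\ 0 & g & a\\ 0 & 0 & d\end{pmatrix}.$$ Let $K\langle Y\cup Z\rangle$ be the free unital associative algebra with involution in the symmetric variables $y_1,y_2,\dots$ ($y_i^*=y_i$) and the skew-symmetric variables $z_1,z_2,\dots$ ($z_i^*=-z_i$). A $T^*$-ideal is a two-sided ideal of $K\langle Y\cup Z\rangle$ invariant under all (unital) endomorphisms commuting with $*$. Let $\mathrm{Id}^*(A)$ be the set of all $*$-identities of $A$, i.e. of all $f\in K\langle Y\cup Z\rangle$ that vanish under every substitution of elements $u_i\in A$ with $u_i^*=u_i$ for the $y_i$ and elements $v_i\in A$ with $v_i^*=-v_i$ for the $z_i$. Write $[f,g]=fg-gf$. Each of the letters $x_1,x_2,x_3,x_4$ below stands for either a symmetric or a skew-symmetric variable, that is, $x_i\in\{y_i,z_i\}$,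 chosen independently. Put $|x_ix_j|=0$ if $[x_i,x_j]$ is skew-symmetric (both variables are symmetric or both are skew-symmetric) and $|x_ix_j|=1$ if $[x_i,x_j]$ is symmetric (one variable of each kind). Then $\mathrm{Id}^*(A)$ is the $T^*$-ideal generated by the following polynomials, i.e. the smallest $T^*$-ideal containing them (in 5, 6 and 7 for all choices of the $x_i$): 1. $z_1y_1z_2y_2z_3$; 2. $[z_1,z_2]$; 3. $[z_1y_1z_2,\,y_2]$; 4. $z_1y_1z_2-z_2y_1z_1$; 5. $(-1)^{|x_1x_2|}[x_1,x_2][x_3,x_4]-(-1)^{|x_3x_4|}[x_3,x_4][x_1,x_2]$; 6. $(-1)^{|x_1x_2|}[x_1,x_2][x_3,x_4]-(-1)^{|x_1x_3|}[x_1,x_3][x_2,x_4]+(-1)^{|x_1x_4|}[x_1,x_4][x_2,x_3]$; 7. $[x_1,x_2]\,z_5\,[x_3,x_4]$. -/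

import Mathlib

/-- An involution (of the first kind) on an associative `K`-algebra: a `K`-linear
anti-automorphism of order two. -/
structure AlgInvolution (K B : Type*) [CommRing K] [Ring B] [Algebra K B] extends B →ₗ[K] B where
  map_mul_rev' : ∀ a b : B, toFun (a * b) = toFun b * toFun a
  involutive' : ∀ a : B, toFun (toFun a) = a

namespace AlgInvolution

variable {K B : Type*} [CommRing K] [Ring B] [Algebra K B]

/-- `a` is symmetric: `a* = a`. -/
def IsSymm (σ : AlgInvolution K B) (a : B) : Prop := σ.toLinearMap a = a

/-- `a` is skew-symmetric: `a* = -a`. -/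
def IsSkew (σ : AlgInvolution K B) (a : B) : Prop := σ.toLinearMap a = -a

end AlgInvolution

/-- The free generators: symmetric variables `y i` and skew-symmetric variables `z i`. -/
inductive StarVar : Type
  | y : ℕ → StarVar
  | z : ℕ → StarVar

/-- The (unital) free associative algebra `K⟨Y ∪ Z⟩`, whose elements are the `*`-polynomials. -/
abbrev StarPoly (K : Type*) [CommRing K] : Type _ := FreeAlgebra K StarVar

namespace StarPoly

variable (K : Type*) [CommRing K]

/-- The symmetric variable `y i`. -/
def y (i : ℕ) : StarPoly K := FreeAlgebra.ι K (StarVar.y i)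

/-- The skew-symmetric variable `z i`. -/
def z (i : ℕ) : StarPoly K := FreeAlgebra.ι K (StarVar.z i)

/-- The image of a free generator under the involution: `y i ↦ y i`, `z i ↦ -z i`. -/
def starVar : StarVar → StarPoly K
  | .y i => y K i
  | .z i => -z K i

/-- The involution of `K⟨Y ∪ Z⟩` as a homomorphism into the opposite algebra. -/
def starHom : StarPoly K →ₐ[K] (StarPoly K)ᵐᵒᵖ :=
  FreeAlgebra.lift K (fun v => MulOpposite.op (starVar K v))

theorem starHom_unop_involutive (f : StarPoly K) :
    (starHom K (starHom K f).unop).unop = f := by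
  induction f using FreeAlgebra.induction with
  | grade0 r => simp only [AlgHom.commutes, MulOpposite.algebraMap_apply, MulOpposite.unop_op]
  | grade1 v => cases v <;> simp [starHom, starVar, y, z]
  | mul a b ha hb => simp only [map_mul, MulOpposite.unop_mul, ha, hb]
  | add a b ha hb => simp only [map_add, MulOpposite.unop_add, ha, hb]

/-- The involution of `K⟨Y ∪ Z⟩`, with `y i* = y i` and `z i* = -z i`. -/
def inv : AlgInvolution K (StarPoly K) where
  toFun f := (starHom K f).unop
  map_add' f g := by simp
  map_smul' c f := by simp
  map_mul_rev' f g := by simp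
  involutive' := starHom_unop_involutive K

/-- Evaluation of a `*`-polynomial at `y i ↦ u i`, `z i ↦ v i`. -/
def eval {B : Type*} [Ring B] [Algebra K B] (u v : ℕ → B) : StarPoly K →ₐ[K] B :=
  FreeAlgebra.lift K (fun x => match x with
    | .y i => u i
    | .z i => v i)

/-- A `T*`-ideal: a two-sided ideal of `K⟨Y ∪ Z⟩` that is invariant under all endomorphisms
commuting with the involution. -/
def IsTStarIdeal (I : TwoSidedIdeal (StarPoly K)) : Prop :=
  ∀ φ : StarPoly K →ₐ[K] StarPoly K,
    (∀ f, φ ((inv K).toLinearMap f) = (inv K).toLinearMap (φ f)) → ∀ f ∈ I, φ f ∈ I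

/-- The `T*`-ideal generated by a set `S`: the intersection of all `T*`-ideals containing `S`. -/
def tStarIdealSpan (S : Set (StarPoly K)) : TwoSidedIdeal (StarPoly K) :=
  sInf {I | IsTStarIdeal K I ∧ S ⊆ (I : Set (StarPoly K))}

/-- The set `Id*(B)` of `*`-polynomial identities of an algebra with involution `(B, σ)`. -/
def identities {B : Type*} [Ring B] [Algebra K B] (σ : AlgInvolution K B) : Set (StarPoly K) :=
  {f | ∀ u v : ℕ → B, (∀ i, σ.IsSymm (u i)) → (∀ i, σ.IsSkew (v i)) → eval K u v f = 0}

/-- A variable `x i` that may be either `y i` (when `t i = true`) or `z i` (otherwise). -/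
def x (t : ℕ → Bool) (i : ℕ) : StarPoly K := if t i = true then y K i else z K i

/-- `|x i x j|`: it is `0` when the commutator `⁅x i, x j⁆` is skew-symmetric (two variables of the
same kind), and `1` when it is symmetric (two variables of different kinds). -/
def par (t : ℕ → Bool) (i j : ℕ) : ℕ := if t i = t j then 0 else 1

theorem isSkew_lie_of_par_eq_zero (t : ℕ → Bool) (i j : ℕ) (h : par t i j = 0) :
    (inv K).IsSkew ⁅x K t i, x K t j⁆ := by
  rcases hi : t i <;> rcases hj : t j <;>
    simp_all [par, AlgInvolution.IsSkew, x, inv, y, z, Ring.lie_def, starHom, starVar]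

theorem isSymm_lie_of_par_eq_one (t : ℕ → Bool) (i j : ℕ) (h : par t i j = 1) :
    (inv K).IsSymm ⁅x K t i, x K t j⁆ := by
  rcases hi : t i <;> rcases hj : t j <;>
    simp_all [par, AlgInvolution.IsSymm, x, inv, y, z, Ring.lie_def, starHom, starVar] <;> abel

/-- The seven types of generating `*`-polynomials; in the last three every `x i` runs
independently over `y i` and `z i`. -/
inductive IsBasic : StarPoly K → Prop
  | one : IsBasic (z K 1 * y K 1 * z K 2 * y K 2 * z K 3)
  | two : IsBasic ⁅z K 1, z K 2⁆
  | three : IsBasic ⁅z K 1 * y K 1 * z K 2, y K 2⁆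
  | four : IsBasic (z K 1 * y K 1 * z K 2 - z K 2 * y K 1 * z K 1)
  | five (t : ℕ → Bool) : IsBasic
      ((-1) ^ par t 1 2 * (⁅x K t 1, x K t 2⁆ * ⁅x K t 3, x K t 4⁆)
        - (-1) ^ par t 3 4 * (⁅x K t 3, x K t 4⁆ * ⁅x K t 1, x K t 2⁆))
  | six (t : ℕ → Bool) : IsBasic
      ((-1) ^ par t 1 2 * (⁅x K t 1, x K t 2⁆ * ⁅x K t 3, x K t 4⁆)
        - (-1) ^ par t 1 3 * (⁅x K t 1, x K t 3⁆ * ⁅x K t 2, x K t 4⁆)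
        + (-1) ^ par t 1 4 * (⁅x K t 1, x K t 4⁆ * ⁅x K t 2, x K t 3⁆))
  | seven (t : ℕ → Bool) : IsBasic (⁅x K t 1, x K t 2⁆ * z K 5 * ⁅x K t 3, x K t 4⁆)

end StarPoly

/-- The algebra `A` of all matrices `!![d, a, c; 0, g, b; 0, 0, d]`, that is,
`A = K(e₁₁ + e₃₃) ⊕ K e₂₂ ⊕ K e₁₂ ⊕ K e₂₃ ⊕ K e₁₃`. -/
def algA (K : Type*) [CommRing K] : Subalgebra K (Matrix (Fin 3) (Fin 3) K) where
  carrier := {M | ∃ d g a b c : K, M = !![d, a, c; 0, g, b; 0, 0, d]}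
  mul_mem' := by
    rintro _ _ ⟨d, g, a, b, c, rfl⟩ ⟨d', g', a', b', c', rfl⟩
    refine ⟨d * d', g * g', d * a' + a * g', g * b' + b * d', d * c' + a * b' + c * d', ?_⟩
    ext i j
    fin_cases i <;> fin_cases j <;> simp [Matrix.mul_apply, Fin.sum_univ_three]
  add_mem' := by
    rintro _ _ ⟨d, g, a, b, c, rfl⟩ ⟨d', g', a', b', c', rfl⟩
    refine ⟨d + d', g + g', a + a', b + b', c + c', ?_⟩
    ext i j
    fin_cases i <;> fin_cases j <;> simp
  algebraMap_mem' := by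
    intro r
    refine ⟨r, r, 0, 0, 0, ?_⟩
    ext i j
    fin_cases i <;> fin_cases j <;> simp [Matrix.algebraMap_matrix_apply]

/-- Reflection of a `3 × 3` matrix in its secondary diagonal. -/
def reflect {K : Type*} (M : Matrix (Fin 3) (Fin 3) K) : Matrix (Fin 3) (Fin 3) K :=
  Matrix.of fun i j => M j.rev i.rev

theorem reflect_eq {K : Type*} [CommRing K] (d g a b c : K) :
    reflect !![d, a, c; 0, g, b; 0, 0, d] = !![d, b, c; 0, g, a; 0, 0, d] := by
  ext i j
  fin_cases i <;> fin_cases j <;> simp [reflect, Fin.rev]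

theorem reflect_mem {K : Type*} [CommRing K] {M : Matrix (Fin 3) (Fin 3) K} (hM : M ∈ algA K) :
    reflect M ∈ algA K := by
  obtain ⟨d, g, a, b, c, rfl⟩ := hM
  exact ⟨d, g, b, a, c, reflect_eq d g a b c⟩

/-- The involution on `A` given by reflection in the secondary diagonal. -/
def invA (K : Type*) [CommRing K] : AlgInvolution K (algA K) where
  toFun M := ⟨reflect M.1, reflect_mem M.2⟩
  map_add' M N := by ext i j; simp [reflect]
  map_smul' c M := by ext i j; simp [reflect]
  map_mul_rev' M N := by
    ext i j
    simp only [reflect, MulMemClass.coe_mul, Matrix.of_apply, Matrix.mul_apply,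
      Fin.sum_univ_three]
    simp [Fin.rev]
    ring
  involutive' M := by ext i j; simp [reflect]

/-! Let `I` be the kernel of `commPart`; it is generated by the skew elements z_i and [y_i, y_j]
(`mem_span_skewGen`). Let `J` be the T*-ideal of the basic polynomials. That `J` consists of
identities is a matrix computation (`isBasic_mem_identities`). Conversely, an identity vanishes on
generic matrices with polynomial entries (`generic_eq_zero`), in which y_i has diagonal (t_i + g_i,
g_i, t_i + g_i); this vanishing already forces membership in `J` (`mem_of_generic_eq_zero`).

The diagonal entries put f in `I`. The first four basic polynomials give I³ ⊆ J
(`commPart_ker_triple_mem`), so two layers remain. Modulo I² + J, f is a combination of terms u X v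
with X a skew generator, and the (0,1) entry reads it as a combination of the vectors `vec X`. The
dependences between these vectors follow from alternation and the Koszul relations, which the
classes of the X satisfy by the Jacobi identity. Hence f lies in I² + J. Modulo `J` it is then a
combination of terms u X m Y, where X m Y is central and symmetric in X and Y, and the (0,2) entry
is a quadratic form in the off-diagonal variables. The dependences between symmetrised products of
the `vec X` need in addition only the Plücker relations, supplied by the sixth basic polynomial
(`mulMulMap_pluecker`).

Both statements on dependences rest on explicit sections built from derivations (`polar_section`,
`polarTwo_section`); their normalisation by Euler's formula needs characteristic zero. -/

/-- The quotient map of the free algebra by a two-sided ideal, as a homomorphism of algebras. -/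
def TwoSidedIdeal.quotientAlgHom {K B : Type*} [CommRing K] [Ring B] [Algebra K B]
    (J : TwoSidedIdeal B) : B →ₐ[K] J.ringCon.Quotient :=
  { J.ringCon.mk' with commutes' := fun _ => rfl }

theorem TwoSidedIdeal.quotientAlgHom_eq_zero_iff {K B : Type*} [CommRing K] [Ring B] [Algebra K B]
    (J : TwoSidedIdeal B) (f : B) : J.quotientAlgHom (K := K) f = 0 ↔ f ∈ J := by
  conv_rhs => rw [← TwoSidedIdeal.ker_ringCon_mk' J, TwoSidedIdeal.mem_ker]
  rfl

theorem AlgInvolution.map_one_eq {K B : Type*} [CommRing K] [Ring B] [Algebra K B]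
    (σ : AlgInvolution K B) : σ.toLinearMap 1 = 1 := by
  have h1 : σ.toLinearMap (σ.toLinearMap 1) = 1 := σ.involutive' 1
  have h2 : σ.toLinearMap (σ.toLinearMap 1 * 1) =
      σ.toLinearMap 1 * σ.toLinearMap (σ.toLinearMap 1) := σ.map_mul_rev' _ _
  rw [mul_one, h1, mul_one] at h2
  exact h2.symm

/-! ### The ideal of identities, and validity of the basic polynomials in `A` -/

namespace StarPoly

variable {K : Type*}

section CommRing

variable [CommRing K]

theorem inv_mul (f g : StarPoly K) : (inv K).toLinearMap (f * g) =
    (inv K).toLinearMap g * (inv K).toLinearMap f := (inv K).map_mul_rev' f g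

theorem inv_inv (f : StarPoly K) : (inv K).toLinearMap ((inv K).toLinearMap f) = f :=
  (inv K).involutive' f

theorem inv_y (i : ℕ) : (inv K).toLinearMap (y K i) = y K i := by
  simp [inv, starHom, starVar, y]

theorem inv_z (i : ℕ) : (inv K).toLinearMap (z K i) = -z K i := by
  simp [inv, starHom, starVar, z]

theorem eval_y {B : Type*} [Ring B] [Algebra K B] (u v : ℕ → B) (i : ℕ) :
    eval K u v (y K i) = u i := by
  simp [eval, y]

theorem eval_z {B : Type*} [Ring B] [Algebra K B] (u v : ℕ → B) (i : ℕ) :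
    eval K u v (z K i) = v i := by
  simp [eval, z]

/-- Induction on `*`-polynomials, in terms of the symmetric and the skew-symmetric variables. -/
theorem induction {p : StarPoly K → Prop} (hC : ∀ r, p (algebraMap K _ r)) (hy : ∀ i, p (y K i))
    (hz : ∀ i, p (z K i)) (hmul : ∀ a b, p a → p b → p (a * b))
    (hadd : ∀ a b, p a → p b → p (a + b)) (f : StarPoly K) : p f := by
  induction f using FreeAlgebra.induction with
  | grade0 r => exact hC r
  | grade1 v => cases v with
    | y i => exact hy i
    | z i => exact hz i
  | mul a b ha hb => exact hmul a b ha hb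
  | add a b ha hb => exact hadd a b ha hb

/-- Evaluation at symmetric and skew-symmetric elements commutes with the involutions. -/
theorem eval_inv {B : Type*} [Ring B] [Algebra K B] (σ : AlgInvolution K B) {u v : ℕ → B}
    (hu : ∀ i, σ.IsSymm (u i)) (hv : ∀ i, σ.IsSkew (v i)) (f : StarPoly K) :
    eval K u v ((inv K).toLinearMap f) = σ.toLinearMap (eval K u v f) := by
  induction f using StarPoly.induction with
  | hC r =>
    have h := (inv K).map_one_eq
    rw [Algebra.algebraMap_eq_smul_one, map_smul, h, map_smul, map_smul, map_one, σ.map_one_eq]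
  | hy i => rw [inv_y, eval_y]; exact (hu i).symm
  | hz i => rw [inv_z, map_neg, eval_z]; exact (hv i).symm
  | hmul a b ha hb =>
    rw [inv_mul, map_mul, ha, hb, map_mul]
    exact (σ.map_mul_rev' _ _).symm
  | hadd a b ha hb => rw [map_add, map_add, ha, hb, map_add, map_add]

/-- The composition of evaluations. -/
theorem eval_comp {B : Type*} [Ring B] [Algebra K B] (u v : ℕ → B)
    (φ : StarPoly K →ₐ[K] StarPoly K) (f : StarPoly K) :
    eval K u v (φ f) =
      eval K (fun i => eval K u v (φ (y K i))) (fun i => eval K u v (φ (z K i))) f := by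
  induction f using StarPoly.induction with
  | hC r => simp
  | hy i => rw [eval_y]
  | hz i => rw [eval_z]
  | hmul a b ha hb => simp only [map_mul, ha, hb]
  | hadd a b ha hb => simp only [map_add, ha, hb]

/-- The identities of an algebra with involution, as a two-sided ideal. -/
def identitiesIdeal {B : Type*} [Ring B] [Algebra K B] (σ : AlgInvolution K B) :
    TwoSidedIdeal (StarPoly K) :=
  .mk' (identities K σ)
    (fun _ _ _ _ => map_zero _)
    (fun hf hg u v hu hv => by rw [map_add, hf u v hu hv, hg u v hu hv, add_zero])
    (fun hf u v hu hv => by rw [map_neg, hf u v hu hv, neg_zero])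
    (fun hg u v hu hv => by rw [map_mul, hg u v hu hv, mul_zero])
    (fun hf u v hu hv => by rw [map_mul, hf u v hu hv, zero_mul])

theorem mem_identitiesIdeal {B : Type*} [Ring B] [Algebra K B] (σ : AlgInvolution K B)
    (f : StarPoly K) : f ∈ identitiesIdeal σ ↔ f ∈ identities K σ := by
  exact TwoSidedIdeal.mem_mk' _ _ _ _ _ _ _

theorem isTStarIdeal_identitiesIdeal {B : Type*} [Ring B] [Algebra K B] (σ : AlgInvolution K B) :
    IsTStarIdeal K (identitiesIdeal σ) := by
  intro φ hφ f hf
  rw [mem_identitiesIdeal] at hf ⊢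
  intro u v hu hv
  rw [eval_comp]
  refine hf _ _ (fun i => ?_) (fun i => ?_)
  · rw [AlgInvolution.IsSymm, ← eval_inv σ hu hv, ← hφ, inv_y]
  · rw [AlgInvolution.IsSkew, ← eval_inv σ hu hv, ← hφ, inv_z, map_neg, map_neg]

theorem isTStarIdeal_tStarIdealSpan (S : Set (StarPoly K)) :
    IsTStarIdeal K (tStarIdealSpan K S) := by
  intro φ hφ f hf
  rw [tStarIdealSpan, TwoSidedIdeal.mem_sInf] at hf ⊢
  exact fun I hI => hI.1 φ hφ f (hf I hI)

theorem subset_tStarIdealSpan (S : Set (StarPoly K)) {f : StarPoly K} (hf : f ∈ S) :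
    f ∈ tStarIdealSpan K S := by
  rw [tStarIdealSpan, TwoSidedIdeal.mem_sInf]
  exact fun I hI => hI.2 hf

end CommRing

section Field

variable [Field K] [CharZero K]

omit [CharZero K] in
theorem exists_of_isSymm_invA {u : algA K} (hu : (invA K).IsSymm u) :
    ∃ d g a c : K, u.1 = !![d, a, c; 0, g, a; 0, 0, d] := by
  obtain ⟨M, d, g, a, b, c, rfl⟩ := u
  have h := congrArg Subtype.val hu
  simp only [invA, LinearMap.coe_mk, AddHom.coe_mk, reflect_eq] at h
  have h1 := congrFun (congrFun h 0) 1
  simp at h1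
  exact ⟨d, g, a, c, by rw [h1]⟩

theorem exists_of_isSkew_invA {v : algA K} (hv : (invA K).IsSkew v) :
    ∃ b : K, v.1 = !![0, b, 0; 0, 0, -b; 0, 0, 0] := by
  obtain ⟨M, d, g, a, b, c, rfl⟩ := v
  have h := congrArg Subtype.val hv
  simp only [invA, LinearMap.coe_mk, AddHom.coe_mk, reflect_eq] at h
  have h1 := congrFun (congrFun h 0) 1
  have h2 := congrFun (congrFun h 0) 0
  have h3 := congrFun (congrFun h 1) 1
  have h4 := congrFun (congrFun h 0) 2
  simp [self_eq_neg] at h1 h2 h3 h4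
  exact ⟨a, by rw [h1, h2, h3, h4]⟩

-- To each variable belongs a pair (s, r): the difference of its diagonal entries and its (0,1)
-- entry. The (0,1) entry of a commutator is a 2 × 2 minor of these pairs, so the sixth identity
-- becomes the Plücker relation.
omit [CharZero K] in
theorem lie_eq_of_shape (d g a c b : ℕ → K) (t : ℕ → Bool)
    {X : ℕ → Matrix (Fin 3) (Fin 3) K}
    (hX : ∀ i, X i = if t i = true then !![d i, a i, c i; 0, g i, a i; 0, 0, d i]
      else !![0, b i, 0; 0, 0, -b i; 0, 0, 0]) :
    ∃ m n : ℕ → ℕ → K, ∃ s r : ℕ → K, (∀ i j, m i j = s i * r j - s j * r i) ∧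
      ∀ i j, X i * X j - X j * X i =
        !![0, m i j, n i j; 0, 0, -(-1) ^ par t i j * m i j; 0, 0, 0] := by
  refine ⟨fun i j => (if t i = true then d i - g i else 0) * (if t j = true then a j else b j) -
      (if t j = true then d j - g j else 0) * (if t i = true then a i else b i),
    fun i j => (X i * X j - X j * X i) 0 2, fun i => if t i = true then d i - g i else 0,
    fun i => if t i = true then a i else b i, fun i j => rfl, fun i j => ?_⟩
  cases hi : t i <;> cases hj : t j <;> ext k l <;> fin_cases k <;> fin_cases l <;>
    simp [hX, hi, hj, par] <;> ring

omit [CharZero K] in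
theorem neg_one_pow_par (t : ℕ → Bool) (i j : ℕ) : (-1 : K) ^ par t i j =
    (if t i = true then 1 else -1) * (if t j = true then 1 else -1) := by
  rw [par]
  cases t i <;> cases t j <;> simp

set_option maxHeartbeats 1000000 in
theorem isBasic_mem_identities {f : StarPoly K} (hf : IsBasic K f) :
    f ∈ identities K (invA K) := by
  intro u v hu hv
  choose d g a c hu' using fun i => exists_of_isSymm_invA (hu i)
  choose b hv' using fun i => exists_of_isSkew_invA (hv i)
  have hx : ∀ t i, (eval K u v (x K t i)).1 =
      if t i = true then !![d i, a i, c i; 0, g i, a i; 0, 0, d i]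
      else !![0, b i, 0; 0, 0, -b i; 0, 0, 0] := by
    intro t i
    unfold x
    split_ifs
    · rw [eval_y, hu']
    · rw [eval_z, hv']
  have hsign : ∀ (n : ℕ) (w : algA K), ((-1) ^ n * w : algA K).1 = (-1 : K) ^ n • w.1 := by
    intro n w
    rcases neg_one_pow_eq_or (algA K) n with h | h <;>
    rcases Nat.even_or_odd n with h' | h' <;> simp [h'.neg_one_pow]
  apply Subtype.ext
  cases hf with
  | one =>
    simp only [map_mul, eval_y, eval_z, MulMemClass.coe_mul, hu', hv', ZeroMemClass.coe_zero]
    ext i j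
    fin_cases i <;> fin_cases j <;> simp [Matrix.mul_apply, Fin.sum_univ_three]
  | two =>
    simp only [Ring.lie_def, map_sub, map_mul, eval_z, MulMemClass.coe_mul,
      AddSubgroupClass.coe_sub, hv', ZeroMemClass.coe_zero]
    ext i j
    fin_cases i <;> fin_cases j <;> simp
    ring
  | three =>
    simp only [Ring.lie_def, map_sub, map_mul, eval_y, eval_z, MulMemClass.coe_mul,
      AddSubgroupClass.coe_sub, hu', hv', ZeroMemClass.coe_zero]
    ext i j
    fin_cases i <;> fin_cases j <;> simp
    ring
  | four =>
    simp only [map_sub, map_mul, eval_y, eval_z, MulMemClass.coe_mul,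
      AddSubgroupClass.coe_sub, hu', hv', ZeroMemClass.coe_zero]
    ext i j
    fin_cases i <;> fin_cases j <;> simp
    ring
  | five t =>
    obtain ⟨m, n, s, r, hm, h⟩ := lie_eq_of_shape d g a c b t (hx t)
    simp only [Ring.lie_def, map_sub, map_mul, map_pow, map_neg, map_one, hsign,
      MulMemClass.coe_mul, AddSubgroupClass.coe_sub, ZeroMemClass.coe_zero, h]
    ext i j
    fin_cases i <;> fin_cases j <;> simp
    ring
  | six t =>
    obtain ⟨m, n, s, r, hm, h⟩ := lie_eq_of_shape d g a c b t (hx t)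
    simp only [Ring.lie_def, map_sub, map_add, map_mul, map_pow, map_neg, map_one, hsign,
      MulMemClass.coe_mul, AddSubgroupClass.coe_sub, AddMemClass.coe_add,
      ZeroMemClass.coe_zero, h]
    ext i j
    fin_cases i <;> fin_cases j <;> simp
    -- The sign attached to each of the three products is the same product of four signs, one per
    -- variable, so only the Plücker relation for the minors remains.
    simp only [hm, neg_one_pow_par]
    ring
  | seven t =>
    obtain ⟨m, n, s, r, hm, h⟩ := lie_eq_of_shape d g a c b t (hx t)
    simp only [Ring.lie_def, map_sub, map_mul, eval_z, hv', MulMemClass.coe_mul,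
      AddSubgroupClass.coe_sub, ZeroMemClass.coe_zero, h]
    ext i j
    fin_cases i <;> fin_cases j <;> simp

theorem tStarIdealSpan_le_identitiesIdeal :
    tStarIdealSpan K {f | IsBasic K f} ≤ identitiesIdeal (invA K) :=
  sInf_le ⟨isTStarIdeal_identitiesIdeal _, fun _ hf =>
    (mem_identitiesIdeal _ _).2 (isBasic_mem_identities hf)⟩

end Field

end StarPoly

/-- A family of pairwise commuting elements of an algebra is the image of the variables under a
homomorphism from the polynomial algebra. -/
theorem MvPolynomial.exists_algHom_of_commute {K B ι : Type*} [Field K] [Ring B] [Algebra K B]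
    (φ : ι → B) (h : ∀ i j, φ i * φ j = φ j * φ i) :
    ∃ Ψ : MvPolynomial ι K →ₐ[K] B, ∀ i, Ψ (MvPolynomial.X i) = φ i := by
  have hc := Algebra.isMulCommutative_adjoin K (s := Set.range φ) (by
    rintro _ ⟨i, rfl⟩ _ ⟨j, rfl⟩
    exact h i j)
  let : CommRing (Algebra.adjoin K (Set.range φ)) :=
    { (inferInstance : Ring (Algebra.adjoin K (Set.range φ))) with
      mul_comm := fun a b => hc.is_comm.comm a b }
  refine ⟨(Algebra.adjoin K (Set.range φ)).val.comp
    (MvPolynomial.aeval fun i => ⟨φ i, Algebra.subset_adjoin ⟨i, rfl⟩⟩), fun i => ?_⟩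
  rw [AlgHom.comp_apply, MvPolynomial.aeval_X]
  rfl

/-! ### The kernel of `commPart`, and consequences of the basic polynomials -/

namespace StarPoly

variable {K : Type*}

section CommRing

variable [CommRing K]

/-- The homomorphism onto the commutative polynomials that kills the skew-symmetric variables. -/
noncomputable def commPart : StarPoly K →ₐ[K] MvPolynomial ℕ K := eval K MvPolynomial.X 0

theorem commPart_y (i : ℕ) : commPart (y K i) = MvPolynomial.X i := eval_y _ _ i

theorem commPart_z (i : ℕ) : commPart (z K i) = 0 := eval_z _ _ i

/-- The skew-symmetric elements `z i` and `y i * y j - y j * y i`. -/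
def skewGen : ℕ ⊕ (ℕ × ℕ) → StarPoly K
  | .inl i => z K i
  | .inr (i, j) => y K i * y K j - y K j * y K i

theorem isSkew_skewGen (X : ℕ ⊕ (ℕ × ℕ)) : (inv K).IsSkew (skewGen X) := by
  rcases X with i | ⟨i, j⟩
  · exact inv_z i
  · simp only [AlgInvolution.IsSkew, skewGen, map_sub, inv_mul, inv_y, neg_sub]

theorem commPart_skewGen (X : ℕ ⊕ (ℕ × ℕ)) : commPart (skewGen X : StarPoly K) = 0 := by
  rcases X with i | ⟨i, j⟩
  · exact commPart_z i
  · rw [skewGen, map_sub, map_mul, map_mul, mul_comm, sub_self]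

end CommRing

section Field

variable [Field K]

/-- Modulo the span the y's commute and the z's vanish, so the quotient map factors through
`commPart`. -/
theorem mem_span_skewGen {f : StarPoly K} (hf : commPart f = 0) :
    f ∈ TwoSidedIdeal.span (Set.range (skewGen (K := K))) := by
  set J := TwoSidedIdeal.span (Set.range (skewGen (K := K)))
  let q := J.quotientAlgHom (K := K)
  have hgen : ∀ X, q (skewGen X) = 0 := fun X =>
    (J.quotientAlgHom_eq_zero_iff _).2 (TwoSidedIdeal.subset_span ⟨X, rfl⟩)
  obtain ⟨Ψ, hΨ⟩ := MvPolynomial.exists_algHom_of_commute (K := K) (fun i => q (y K i)) (by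
    intro i j
    have h := hgen (.inr (i, j))
    rw [skewGen, map_sub, map_mul, map_mul] at h
    exact sub_eq_zero.1 h)
  have key : ∀ g : StarPoly K, Ψ (commPart g) = q g := by
    intro g
    induction g using StarPoly.induction with
    | hC r => simp
    | hy i => rw [commPart_y, hΨ]
    | hz i => rw [commPart_z, map_zero]; exact (hgen (.inl i)).symm
    | hmul a b ha hb => simp only [map_mul, ha, hb]
    | hadd a b ha hb => simp only [map_add, ha, hb]
  rw [← J.quotientAlgHom_eq_zero_iff (K := K)]
  rw [← key, hf, map_zero]

/-- Induction on the kernel of `commPart`. -/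
theorem commPart_ker_induction {p : StarPoly K → Prop} (hadd : ∀ a b, p a → p b → p (a + b))
    (hgen : ∀ u X v, p (u * skewGen X * v)) {f : StarPoly K} (hf : commPart f = 0) : p f := by
  have h := mem_span_skewGen hf
  rw [TwoSidedIdeal.mem_span_iff_mem_addSubgroup_closure] at h
  -- `p` is only assumed additive; carrying `-f` along handles negation in the additive closure.
  have h2 : p f ∧ p (-f) := by
    clear hf
    induction h using AddSubgroup.closure_induction with
    | mem x hx =>
      obtain ⟨_, ⟨u, -, _, ⟨X, rfl⟩, rfl⟩, v, -, rfl⟩ := hx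
      refine ⟨hgen u X v, ?_⟩
      have := hgen (-u) X v
      simpa only [neg_mul] using this
    | zero =>
      have := hgen 0 (.inl 0) 0
      rw [mul_zero] at this
      exact ⟨this, by rwa [neg_zero]⟩
    | add a b _ _ ha hb =>
      exact ⟨hadd _ _ ha.1 hb.1, by rw [neg_add]; exact hadd _ _ ha.2 hb.2⟩
    | neg a _ ha => exact ⟨ha.2, by rw [neg_neg]; exact ha.1⟩
  exact h2.1

variable [CharZero K]

theorem exists_symm_add_skew (w : StarPoly K) :
    ∃ p k, (inv K).IsSymm p ∧ (inv K).IsSkew k ∧ w = p + k := by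
  refine ⟨(2 : K)⁻¹ • (w + (inv K).toLinearMap w), (2 : K)⁻¹ • (w - (inv K).toLinearMap w),
    ?_, ?_, ?_⟩
  · rw [AlgInvolution.IsSymm, map_smul, map_add, inv_inv, add_comm]
  · rw [AlgInvolution.IsSkew, map_smul, map_sub, inv_inv, ← smul_neg, neg_sub]
  · rw [← smul_add, add_add_sub_cancel, ← two_smul K, smul_smul, inv_mul_cancel₀ two_ne_zero,
      one_smul]

section Consequences

variable {J : TwoSidedIdeal (StarPoly K)} (hJ : IsTStarIdeal K J)
  (hB : ∀ f, IsBasic K f → f ∈ J)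

include hJ hB

omit [CharZero K] in
theorem eval_basic_mem {f : StarPoly K} (hf : IsBasic K f) {p s : ℕ → StarPoly K}
    (hp : ∀ i, (inv K).IsSymm (p i)) (hs : ∀ i, (inv K).IsSkew (s i)) : eval K p s f ∈ J :=
  hJ (eval K p s) (eval_inv (inv K) hp hs) f (hB f hf)

omit [CharZero K] in
/-- The consequences of the first four basic polynomials for arbitrary symmetric `p i` and
skew-symmetric `s i`. -/
theorem basic_consequences {p₁ p₂ s₁ s₂ s₃ : StarPoly K} (hp₁ : (inv K).IsSymm p₁)
    (hp₂ : (inv K).IsSymm p₂) (hs₁ : (inv K).IsSkew s₁) (hs₂ : (inv K).IsSkew s₂)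
    (hs₃ : (inv K).IsSkew s₃) :
    s₁ * p₁ * s₂ * p₂ * s₃ ∈ J ∧ s₁ * s₂ - s₂ * s₁ ∈ J ∧
      s₁ * p₁ * s₂ * p₂ - p₂ * (s₁ * p₁ * s₂) ∈ J ∧ s₁ * p₁ * s₂ - s₂ * p₁ * s₁ ∈ J := by
  let p : ℕ → StarPoly K := fun i => if i = 1 then p₁ else p₂
  let s : ℕ → StarPoly K := fun i => if i = 1 then s₁ else if i = 2 then s₂ else s₃
  have hp : ∀ i, (inv K).IsSymm (p i) := by
    intro i
    simp only [p]
    split_ifs <;> assumption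
  have hs : ∀ i, (inv K).IsSkew (s i) := by
    intro i
    simp only [s]
    split_ifs <;> assumption
  have h1 := eval_basic_mem hJ hB .one hp hs
  have h2 := eval_basic_mem hJ hB .two hp hs
  have h3 := eval_basic_mem hJ hB .three hp hs
  have h4 := eval_basic_mem hJ hB .four hp hs
  simp only [Ring.lie_def, map_mul, map_sub, eval_y, eval_z, p, s, if_true, OfNat.ofNat_ne_one,
    if_false, Nat.reduceEqDiff] at h1 h2 h3 h4
  exact ⟨h1, h2, h3, h4⟩

omit [CharZero K] in
theorem skew_mul_skew_mul_skew_mem {s₁ s₂ s₃ : StarPoly K} (hs₁ : (inv K).IsSkew s₁)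
    (hs₂ : (inv K).IsSkew s₂) (hs₃ : (inv K).IsSkew s₃) : s₁ * s₂ * s₃ ∈ J := by
  have h := (basic_consequences hJ hB (inv K).map_one_eq (inv K).map_one_eq hs₁ hs₂ hs₃).1
  simpa only [mul_one] using h

/-- Split w and w' into symmetric and skew parts. The symmetric parts fall under the first basic
polynomial; each other term contains three adjacent skew factors, the case of that polynomial with
both y's equal to 1. -/
theorem skew_triple_mem {s₁ s₂ s₃ : StarPoly K} (hs₁ : (inv K).IsSkew s₁)
    (hs₂ : (inv K).IsSkew s₂) (hs₃ : (inv K).IsSkew s₃) (w w' : StarPoly K) :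
    s₁ * w * s₂ * w' * s₃ ∈ J := by
  obtain ⟨p, k, hp, hk, rfl⟩ := exists_symm_add_skew w
  obtain ⟨p', k', hp', hk', rfl⟩ := exists_symm_add_skew w'
  have h1 := (basic_consequences hJ hB hp hp' hs₁ hs₂ hs₃).1
  have h2 := J.mul_mem_right _ ((p' + k') * s₃) (skew_mul_skew_mul_skew_mem hJ hB hs₁ hk hs₂)
  have h3 := J.mul_mem_left (s₁ * p) _ (skew_mul_skew_mul_skew_mem hJ hB hs₂ hk' hs₃)
  convert J.add_mem (J.add_mem h1 h2) h3 using 1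
  noncomm_ring

theorem skew_mul_mul_skew_comm_mem {s₁ s₂ : StarPoly K} (hs₁ : (inv K).IsSkew s₁)
    (hs₂ : (inv K).IsSkew s₂) (w : StarPoly K) : s₁ * w * s₂ - s₂ * w * s₁ ∈ J := by
  obtain ⟨p, k, hp, hk, rfl⟩ := exists_symm_add_skew w
  have h1 := (basic_consequences hJ hB hp hp hs₁ hs₂ hs₂).2.2.2
  have h2 := skew_mul_skew_mul_skew_mem hJ hB hs₁ hk hs₂
  have h3 := skew_mul_skew_mul_skew_mem hJ hB hs₂ hk hs₁
  convert J.sub_mem (J.add_mem h1 h2) h3 using 1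
  noncomm_ring

/-- The skew part of x produces skew triples, and so does the skew part of w; for symmetric w and x
this is the third basic polynomial. -/
theorem skew_mul_mul_skew_central_mem {s₁ s₂ : StarPoly K} (hs₁ : (inv K).IsSkew s₁)
    (hs₂ : (inv K).IsSkew s₂) (w x : StarPoly K) :
    s₁ * w * s₂ * x - x * (s₁ * w * s₂) ∈ J := by
  obtain ⟨p', k', hp', hk', rfl⟩ := exists_symm_add_skew x
  have h1 : s₁ * w * s₂ * 1 * k' ∈ J := skew_triple_mem hJ hB hs₁ hs₂ hk' _ _
  have h2 : k' * 1 * s₁ * w * s₂ ∈ J := skew_triple_mem hJ hB hk' hs₁ hs₂ _ _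
  obtain ⟨p, k, hp, hk, rfl⟩ := exists_symm_add_skew w
  have h3 := (basic_consequences hJ hB hp hp' hs₁ hs₂ hs₂).2.2.1
  have h4 := skew_mul_skew_mul_skew_mem hJ hB hs₁ hk hs₂
  convert J.add_mem (J.add_mem h3 (J.sub_mem (J.mul_mem_right _ p' h4) (J.mul_mem_left p' _ h4)))
    (J.sub_mem h1 h2) using 1
  noncomm_ring

/-- This is I³ ⊆ J: only the linear and the quadratic layer of I survive modulo J. -/
theorem commPart_ker_triple_mem {f g h : StarPoly K} (hf : commPart f = 0) (hg : commPart g = 0)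
    (hh : commPart h = 0) : f * g * h ∈ J := by
  refine commPart_ker_induction (p := fun f => f * g * h ∈ J)
    (fun a b ha hb => ?_) (fun u X v => ?_) hf
  · rw [add_mul, add_mul]; exact J.add_mem ha hb
  refine commPart_ker_induction (p := fun g => u * skewGen X * v * g * h ∈ J)
    (fun a b ha hb => ?_) (fun u' X' v' => ?_) hg
  · rw [mul_add, add_mul]; exact J.add_mem ha hb
  refine commPart_ker_induction
    (p := fun h => u * skewGen X * v * (u' * skewGen X' * v') * h ∈ J)
    (fun a b ha hb => ?_) (fun u'' X'' v'' => ?_) hh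
  · rw [mul_add]; exact J.add_mem ha hb
  · have := J.mul_mem_right _ v'' (J.mul_mem_left u _ (skew_triple_mem hJ hB (isSkew_skewGen X)
      (isSkew_skewGen X') (isSkew_skewGen X'') (v * u') (v' * u'')))
    simpa only [mul_assoc] using this

omit [CharZero K] in
theorem pluecker_mem (i j k l : ℕ) :
    skewGen (.inr (i, j)) * skewGen (.inr (k, l)) - skewGen (.inr (i, k)) * skewGen (.inr (j, l))
      + skewGen (.inr (i, l)) * skewGen (.inr (j, k)) ∈ J := by
  have h := eval_basic_mem hJ hB (.six fun _ => true)
    (p := fun n => if n = 1 then y K i else if n = 2 then y K j else if n = 3 then y K k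
      else y K l) (s := fun _ => 0)
    (by intro n; split_ifs <;> exact inv_y _)
    (by intro n; simp [AlgInvolution.IsSkew])
  simpa [par, x, Ring.lie_def, eval_y, skewGen] using h

end Consequences

end Field

end StarPoly

/-! ### Sections for the Koszul relations, in first and second order -/

namespace Koszul

open MvPolynomial

noncomputable section

/-- Polynomials in two sequences of variables. -/
abbrev BiPoly (K : Type*) [Field K] : Type _ := MvPolynomial (ℕ ⊕ ℕ) K

variable {K : Type*} [Field K]

/-- The variable `t i`. -/
def t (i : ℕ) : BiPoly K := X (.inl i)

/-- The variable `g i`. -/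
def g (i : ℕ) : BiPoly K := X (.inr i)

theorem poly_induction {p : BiPoly K → Prop} (hC : ∀ r, p (C r))
    (hadd : ∀ a b, p a → p b → p (a + b)) (ht : ∀ a i, p a → p (a * t i))
    (hg : ∀ a i, p a → p (a * g i)) (P : BiPoly K) : p P := by
  induction P using MvPolynomial.induction_on with
  | C r => exact hC r
  | add a b ha hb => exact hadd a b ha hb
  | mul_X a v ha => cases v with
    | inl i => exact ht a i ha
    | inr i => exact hg a i ha

/-- The degree of a monomial in the variables `t i`. -/
def tDegree : (ℕ ⊕ ℕ →₀ ℕ) →+ ℕ := Finsupp.weight (Sum.elim (fun _ => 1) (fun _ => 0))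

/-- Multiplication of the component of degree `n` in the variables `t i` by `φ n`. -/
def scale (φ : ℕ → K) : BiPoly K →ₗ[K] BiPoly K :=
  (basisMonomials (ℕ ⊕ ℕ) K).constr K fun m => φ (tDegree m) • monomial m 1

theorem scale_monomial (φ : ℕ → K) (m : ℕ ⊕ ℕ →₀ ℕ) (r : K) :
    scale φ (monomial m r) = φ (tDegree m) • monomial m r := by
  have h : monomial m r = r • (basisMonomials (ℕ ⊕ ℕ) K) m := by
    rw [coe_basisMonomials, smul_monomial, smul_eq_mul, mul_one]
  rw [h, map_smul, scale, Module.Basis.constr_basis, coe_basisMonomials, smul_comm]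

theorem scale_C (φ : ℕ → K) (r : K) : scale φ (C r) = φ 0 • C r := by
  have h := scale_monomial φ 0 r
  rwa [map_zero] at h

theorem scale_scale (φ ψ : ℕ → K) (P : BiPoly K) :
    scale φ (scale ψ P) = scale (fun n => φ n * ψ n) P := by
  induction P using MvPolynomial.induction_on' with
  | monomial m r => simp only [scale_monomial, map_smul, smul_smul, mul_comm]
  | add p q hp hq => simp only [map_add, hp, hq]

theorem scale_mul_t (φ : ℕ → K) (P : BiPoly K) (i : ℕ) :
    scale φ (P * t i) = scale (fun n => φ (n + 1)) P * t i := by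
  induction P using MvPolynomial.induction_on' with
  | monomial m r =>
    have h : tDegree (m + Finsupp.single (Sum.inl i) 1) = tDegree m + 1 := by
      simp [tDegree, Finsupp.weight_single]
    rw [t, X, monomial_mul, scale_monomial, scale_monomial, h, smul_mul_assoc, monomial_mul]
  | add p q hp hq => simp only [map_add, add_mul, hp, hq]

theorem scale_mul_g (φ : ℕ → K) (P : BiPoly K) (i : ℕ) :
    scale φ (P * g i) = scale φ P * g i := by
  induction P using MvPolynomial.induction_on' with
  | monomial m r =>
    have h : tDegree (m + Finsupp.single (Sum.inr i) 1) = tDegree m := by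
      simp [tDegree, Finsupp.weight_single]
    rw [g, X, monomial_mul, scale_monomial, scale_monomial, h, smul_mul_assoc, monomial_mul]
  | add p q hp hq => simp only [map_add, add_mul, hp, hq]

/-- The Euler derivation with respect to the variables `t i`. -/
def euler : Derivation K (BiPoly K) (BiPoly K) := mkDerivation K (Sum.elim t 0)

theorem euler_t (i : ℕ) : euler (t i : BiPoly K) = t i := mkDerivation_X _ _ _

theorem euler_g (i : ℕ) : euler (g i : BiPoly K) = 0 := mkDerivation_X _ _ _

theorem euler_eq_scale (P : BiPoly K) : euler P = scale (fun n => (n : K)) P := by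
  induction P using poly_induction with
  | hC r => rw [scale_C, Nat.cast_zero, zero_smul, derivation_C]
  | hadd a b ha hb => rw [map_add, map_add, ha, hb]
  | ht a i ha =>
    have h : scale (fun n => ((n + 1 : ℕ) : K)) a = scale (fun n => (n : K)) a + a := by
      clear ha
      induction a using MvPolynomial.induction_on' with
      | monomial m r => simp only [scale_monomial, Nat.cast_add, Nat.cast_one, add_smul, one_smul]
      | add p q hp hq => simp only [map_add, hp, hq]; ring
    rw [Derivation.leibniz, ha, euler_t, scale_mul_t, h, smul_eq_mul, smul_eq_mul]
    ring
  | hg a i ha =>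
    rw [Derivation.leibniz, ha, euler_g, scale_mul_g, smul_eq_mul, smul_eq_mul]
    ring

theorem scale_eq_self {φ : ℕ → K} (h : ∀ n, φ n = 1) (P : BiPoly K) : scale φ P = P := by
  induction P using MvPolynomial.induction_on' with
  | monomial m r => rw [scale_monomial, h, one_smul]
  | add p q hp hq => rw [map_add, hp, hq]

theorem scale_add (φ ψ : ℕ → K) (P : BiPoly K) :
    scale (fun n => φ n + ψ n) P = scale φ P + scale ψ P := by
  induction P using MvPolynomial.induction_on' with
  | monomial m r => simp only [scale_monomial, add_smul]
  | add p q hp hq => simp only [map_add, hp, hq]; ring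

theorem scale_const_mul (r : K) (φ : ℕ → K) (P : BiPoly K) :
    scale (fun n => r * φ n) P = r • scale φ P := by
  induction P using MvPolynomial.induction_on' with
  | monomial m s => simp only [scale_monomial, mul_smul]
  | add p q hp hq => simp only [map_add, hp, hq, smul_add]

section Module

variable {N : Type*} [AddCommGroup N] [Module K N] [Module (BiPoly K) N]
  [IsScalarTower K (BiPoly K) N]

/-- The derivation that sends `t p` to `c p j`. -/
def polar (c : ℕ → ℕ → N) (j : ℕ) : Derivation K (BiPoly K) N :=
  mkDerivation K (Sum.elim (fun p => c p j) 0)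

theorem polar_t (c : ℕ → ℕ → N) (j p : ℕ) : polar c j (t p : BiPoly K) = c p j :=
  mkDerivation_X _ _ _

theorem polar_g (c : ℕ → ℕ → N) (j p : ℕ) : polar c j (g p : BiPoly K) = 0 := mkDerivation_X _ _ _

theorem polar_C (c : ℕ → ℕ → N) (j : ℕ) (r : K) : polar c j (C r) = 0 := by
  exact derivation_C _ _

/-- Both sides are derivations in P that vanish on the g's, and at P = t_p the formula is the Koszul
relation. -/
theorem smul_polar_sub {c : ℕ → ℕ → N}
    (hc : ∀ i j p, (t i : BiPoly K) • c p j - (t j : BiPoly K) • c p i = (t p : BiPoly K) • c i j)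
    (i j : ℕ) (P : BiPoly K) :
    (t i : BiPoly K) • polar c j P - (t j : BiPoly K) • polar c i P = euler P • c i j := by
  induction P using poly_induction with
  | hC r =>
    rw [polar_C, polar_C, euler_eq_scale, scale_C, Nat.cast_zero, zero_smul, zero_smul, smul_zero,
      smul_zero, sub_zero]
  | hadd a b ha hb =>
    rw [map_add, map_add, map_add]
    linear_combination (norm := module) ha + hb
  | ht a p ha =>
    rw [Derivation.leibniz, Derivation.leibniz, Derivation.leibniz, polar_t, polar_t, euler_t,
      smul_eq_mul, smul_eq_mul]
    linear_combination (norm := module) (t p : BiPoly K) • ha + a • hc i j p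
  | hg a p ha =>
    rw [Derivation.leibniz, Derivation.leibniz, Derivation.leibniz, polar_g, polar_g, euler_g,
      smul_eq_mul, smul_eq_mul]
    linear_combination (norm := module) (g p : BiPoly K) • ha

/-- The normalisation that makes `polar` a section of the Koszul differential. -/
def normOne : BiPoly K →ₗ[K] BiPoly K := scale fun n => ((n : K) + 1)⁻¹

theorem polar_section [CharZero K] {c : ℕ → ℕ → N}
    (hc : ∀ i j p, (t i : BiPoly K) • c p j - (t j : BiPoly K) • c p i = (t p : BiPoly K) • c i j)
    (ha : ∀ i j, c j i = - c i j) (i j : ℕ) (P : BiPoly K) :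
    polar c j (normOne (P * t i)) - polar c i (normOne (P * t j)) = P • c i j := by
  rw [normOne, scale_mul_t, scale_mul_t]
  set Q := scale (fun n => (((n + 1 : ℕ) : K) + 1)⁻¹) P with hQ
  -- The product rule yields Q twice, from the derivatives of t_i and t_j, and `smul_polar_sub`
  -- yields `euler Q`. The total factor in degree n is n + 2, which the shifted normalisation
  -- inverts.
  have h1 : 2 * Q + euler Q = P := by
    rw [← map_ofNat (algebraMap K (BiPoly K)) 2, ← Algebra.smul_def, euler_eq_scale, hQ,
      scale_scale, ← scale_const_mul, ← scale_add]
    refine scale_eq_self (fun n => ?_) P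
    have : ((n + 1 : ℕ) : K) + 1 ≠ 0 := Nat.cast_add_one_ne_zero _
    rw [← add_mul]
    convert mul_inv_cancel₀ this using 2
    push_cast
    ring
  have h2 := smul_polar_sub hc i j Q
  rw [Derivation.leibniz, Derivation.leibniz, polar_t, polar_t, ha i j]
  conv_rhs => rw [← h1]
  linear_combination (norm := module) h2

/-- The total derivative with respect to the variables `t i`. -/
def grad : Derivation K (BiPoly K) (ℕ →₀ BiPoly K) :=
  mkDerivation K (Sum.elim (fun q => Finsupp.single q 1) 0)

theorem grad_t (i : ℕ) : grad (t i : BiPoly K) = Finsupp.single i 1 := mkDerivation_X _ _ _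

theorem linearCombination_grad {M : Type*} [AddCommGroup M] [Module K M] [Module (BiPoly K) M]
    [IsScalarTower K (BiPoly K) M] (m : ℕ → M) (P : BiPoly K) :
    Finsupp.linearCombination (BiPoly K) m (grad P) = mkDerivation K (Sum.elim m 0) P := by
  have h : (Finsupp.linearCombination (BiPoly K) m).compDer grad =
      mkDerivation K (Sum.elim m 0) := by
    refine derivation_ext fun v => ?_
    change Finsupp.linearCombination (BiPoly K) m (grad (X v)) = _
    cases v with
    | inl i =>
      rw [grad, mkDerivation_X, mkDerivation_X, Sum.elim_inl, Sum.elim_inl,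
        Finsupp.linearCombination_single, one_smul]
    | inr i => rw [grad, mkDerivation_X, mkDerivation_X, Sum.elim_inr, Sum.elim_inr,
        Pi.zero_apply, Pi.zero_apply, map_zero]
  exact congrArg (fun D => D P) h

/-- The sum of the derivatives `polar (c · · q l) j` of the entries of a vector. -/
def contract (c : ℕ → ℕ → ℕ → ℕ → N) (j l : ℕ) : (ℕ →₀ BiPoly K) →ₗ[K] N :=
  Finsupp.lsum K fun q => (polar (fun p r => c p r q l) j).toLinearMap

theorem contract_single (c : ℕ → ℕ → ℕ → ℕ → N) (j l q : ℕ) (r : BiPoly K) :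
    contract c j l (Finsupp.single q r) = polar (fun p r => c p r q l) j r := by
  rw [contract, Finsupp.lsum_single]
  rfl

theorem contract_smul (c : ℕ → ℕ → ℕ → ℕ → N) (j l : ℕ) (Q : BiPoly K) (v : ℕ →₀ BiPoly K) :
    contract c j l (Q • v) = Q • contract c j l v +
      Finsupp.linearCombination (BiPoly K) (fun q => polar (fun p r => c p r q l) j Q) v := by
  induction v using Finsupp.induction_linear with
  | zero => simp
  | add v w hv hw =>
    rw [smul_add, map_add, map_add, map_add, hv, hw]
    module
  | single q r =>
    rw [Finsupp.smul_single, contract_single, contract_single, Finsupp.linearCombination_single,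
      smul_eq_mul, Derivation.leibniz]

/-- The second order polarisation. -/
def polarTwo (c : ℕ → ℕ → ℕ → ℕ → N) (j l : ℕ) : BiPoly K →ₗ[K] N :=
  contract c j l ∘ₗ grad.toLinearMap

theorem polarTwo_apply (c : ℕ → ℕ → ℕ → ℕ → N) (j l : ℕ) (P : BiPoly K) :
    polarTwo c j l P = contract c j l (grad P) := rfl

/-- Formally, `polarTwo c j l P` is the sum over p, q of ∂_p ∂_q P • c p j q l, with derivatives in
the t's. This is the second order product rule: t_i t_k receives no derivative, one, or both. -/
theorem polarTwo_mul_t_mul_t {c : ℕ → ℕ → ℕ → ℕ → N} (hsym : ∀ i j k l, c i j k l = c k l i j)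
    (i j k l : ℕ) (P : BiPoly K) :
    polarTwo c j l (P * t i * t k) = (t i * t k : BiPoly K) • polarTwo c j l P +
      (t i : BiPoly K) • polar (c k j) l P + (t k : BiPoly K) • polar (c i j) l P +
      (t i : BiPoly K) • polar (c k l) j P + (t k : BiPoly K) • polar (c i l) j P +
      P • (c i j k l + c k j i l) := by
  have h1 : Finsupp.linearCombination (BiPoly K)
      (fun q => polar (fun p r => c p r q l) j (t i * t k : BiPoly K)) (grad P) =
      (t i : BiPoly K) • polar (c k j) l P + (t k : BiPoly K) • polar (c i j) l P := by
    have h : (fun q => polar (fun p r => c p r q l) j (t i * t k : BiPoly K)) =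
        (t i : BiPoly K) • (fun q => c k j q l) + (t k : BiPoly K) • (fun q => c i j q l) := by
      funext q
      rw [Derivation.leibniz, polar_t, polar_t]
      rfl
    rw [h, polar, polar, ← linearCombination_grad, ← linearCombination_grad]
    generalize grad P = v
    induction v using Finsupp.induction_linear with
    | zero => simp
    | add v w hv hw =>
      rw [map_add, map_add, map_add, hv, hw]
      module
    | single q r =>
      simp only [Finsupp.linearCombination_single, Pi.add_apply, Pi.smul_apply]
      module
  have h2 : ∀ a b, (fun p r => c p r a b) = c a b := by
    intro a b
    funext p r
    exact hsym _ _ _ _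
  rw [mul_assoc, polarTwo_apply, Derivation.leibniz, map_add, contract_smul c j l (t i * t k), h1,
    Derivation.leibniz, grad_t, grad_t, smul_add, map_add, Finsupp.smul_single,
    Finsupp.smul_single, Finsupp.smul_single, Finsupp.smul_single, contract_single,
    contract_single, smul_eq_mul, smul_eq_mul, smul_eq_mul, smul_eq_mul, mul_one, mul_one,
    Derivation.leibniz, Derivation.leibniz, polar_t, polar_t, h2, h2, polarTwo_apply,
    hsym k j i l]
  module

/-- Apply the first order formula to each ∂_q P and then the Koszul relation in the second pair of
indices. What remains is the operator Σ t_p t_q ∂_p ∂_q, which equals E² - E for the Euler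
derivation E. -/
theorem polarTwo_antisymm {c : ℕ → ℕ → ℕ → ℕ → N}
    (hc : ∀ i j p k l, (t i : BiPoly K) • c p j k l - (t j : BiPoly K) • c p i k l =
      (t p : BiPoly K) • c i j k l)
    (hsym : ∀ i j k l, c i j k l = c k l i j) (i j k l : ℕ) (P : BiPoly K) :
    (t i * t k : BiPoly K) • polarTwo c j l P - (t j * t k : BiPoly K) • polarTwo c i l P
      - (t i * t l : BiPoly K) • polarTwo c j k P + (t j * t l : BiPoly K) • polarTwo c i k P =
    (euler (euler P) - euler P) • c i j k l := by
  have h1 : Finsupp.linearCombination (BiPoly K) t (grad P) = euler P := linearCombination_grad _ _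
  simp only [polarTwo_apply]
  rw [← h1]
  generalize grad P = v
  induction v using Finsupp.induction_linear with
  | zero => simp
  | add v w hv hw =>
    simp only [map_add]
    linear_combination (norm := module) hv + hw
  | single q r =>
    simp only [contract_single, Finsupp.linearCombination_single, smul_eq_mul, Derivation.leibniz,
      euler_t]
    have h2 := smul_polar_sub (c := fun p r => c p r q l) (fun a b p => hc a b p q l) i j r
    have h3 := smul_polar_sub (c := fun p r => c p r q k) (fun a b p => hc a b p q k) i j r
    have h4 := hc k l q i j
    rw [hsym q l, hsym q k, hsym k l] at h4
    linear_combination (norm := module) (t k : BiPoly K) • h2 - (t l : BiPoly K) • h3 + euler r • h4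

/-- The normalisation that makes `polarTwo` a section. -/
def normTwo : BiPoly K →ₗ[K] BiPoly K := scale fun n => ((n : K) * (n + 1))⁻¹

theorem polarTwo_section [CharZero K] {c : ℕ → ℕ → ℕ → ℕ → N}
    (hc : ∀ i j p k l, (t i : BiPoly K) • c p j k l - (t j : BiPoly K) • c p i k l =
      (t p : BiPoly K) • c i j k l)
    (ha : ∀ i j k l, c j i k l = - c i j k l)
    (hsym : ∀ i j k l, c i j k l = c k l i j)
    (hp : ∀ i j k l, c i j k l - c i k j l + c i l j k = 0) (i j k l : ℕ) (P : BiPoly K) :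
    polarTwo c j l (normTwo (P * t i * t k)) - polarTwo c i l (normTwo (P * t j * t k))
      - polarTwo c j k (normTwo (P * t i * t l)) + polarTwo c i k (normTwo (P * t j * t l)) =
    P • c i j k l := by
  simp only [normTwo, scale_mul_t]
  -- Two factors t shift the degree by 2, so the value of `normTwo` in degree 0, an inverse of zero,
  -- never enters.
  set Q := scale (fun n => (((n + 1 + 1 : ℕ) : K) * ((n + 1 + 1 : ℕ) + 1))⁻¹) P with hQ
  -- In degree n this is (n + 2)(n + 3) = n² + 5n + 6.
  have h1 : 6 * Q + 5 * euler Q + euler (euler Q) = P := by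
    rw [← map_ofNat (algebraMap K (BiPoly K)) 6, ← map_ofNat (algebraMap K (BiPoly K)) 5,
      ← Algebra.smul_def, ← Algebra.smul_def, euler_eq_scale, euler_eq_scale, hQ, scale_scale,
      scale_scale, ← scale_const_mul, ← scale_const_mul, ← scale_add, ← scale_add]
    refine scale_eq_self (fun n => ?_) P
    have e1 : ((n + 1 + 1 : ℕ) : K) ≠ 0 := Nat.cast_ne_zero.2 (Nat.succ_ne_zero _)
    have e2 : ((n + 1 + 1 : ℕ) : K) + 1 ≠ 0 := Nat.cast_add_one_ne_zero _
    have e := mul_inv_cancel₀ (mul_ne_zero e1 e2)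
    change (6 : K) * _ + (5 : K) * _ + _ = 1
    generalize (((n + 1 + 1 : ℕ) : K) * (((n + 1 + 1 : ℕ) : K) + 1))⁻¹ = r at e ⊢
    push_cast at e
    linear_combination e
  have hc' : ∀ a b i j p, (t i : BiPoly K) • c a b p j - (t j : BiPoly K) • c a b p i =
      (t p : BiPoly K) • c a b i j := by
    intro a b i j p
    rw [hsym a b p j, hsym a b p i, hsym a b i j]
    exact hc _ _ _ _ _
  have hmix : ∀ i j k l, (t i : BiPoly K) • polar (c k j) l Q -
      (t j : BiPoly K) • polar (c k i) l Q =
      (t k : BiPoly K) • polar (c i j) l Q := by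
    intro i j k l
    have h : (t i : BiPoly K) • polar (K := K) (c k j) l - (t j : BiPoly K) • polar (c k i) l =
        (t k : BiPoly K) • polar (c i j) l := by
      refine derivation_ext fun v => ?_
      cases v with
      | inl p =>
        have := hc i j k p l
        simpa only [Derivation.coe_sub, Derivation.coe_smul, Pi.sub_apply, Pi.smul_apply, polar,
          mkDerivation_X, Sum.elim_inl] using this
      | inr p => simp [polar, mkDerivation_X]
    have h2 := congrArg (fun D => D Q) h
    simpa only [Derivation.coe_sub, Derivation.coe_smul, Pi.sub_apply, Pi.smul_apply] using h2
  rw [polarTwo_mul_t_mul_t hsym, polarTwo_mul_t_mul_t hsym, polarTwo_mul_t_mul_t hsym,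
    polarTwo_mul_t_mul_t hsym]
  have k1 := polarTwo_antisymm hc hsym i j k l Q
  have k2 := smul_polar_sub (hc' i j) k l Q
  have k3 := smul_polar_sub (hc' k l) i j Q
  have hanti : ∀ (a b l : ℕ) (P : BiPoly K), polar (c b a) l P = - polar (c a b) l P := by
    intro a b l P
    have h : polar (K := K) (c b a) l = - polar (c a b) l := by
      refine derivation_ext fun v => ?_
      cases v with
      | inl p => simp [polar, mkDerivation_X, ha a b]
      | inr p => simp [polar, mkDerivation_X]
    rw [h, Derivation.neg_apply]
  have a1 : ∀ a b p q, c a b q p = - c a b p q := by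
    intro a b p q
    rw [hsym, ha, hsym]
  rw [hsym k l i j] at k3
  have m1 := hmix i j k l
  have m2 := hmix i j l k
  have m3 := hmix k l i j
  have m4 := hmix k l j i
  rw [hanti i j l, hanti i j k, hanti k l j, hanti k l i, hsym k j i l, hsym l j i k, a1 i l j k,
    a1 i k j l, ha i k j l, ha i l j k, ha i j l k, ha i j k l, a1 i j k l]
  conv_rhs => rw [← h1]
  -- `k1` gives E² - E. The first order terms give 6E: two from each of `k2` and `k3` directly, and
  -- one more from each after the mixed terms are collected by `hmix`. The terms without derivatives
  -- give 4, and the Plücker relation turns the crossed ones into 2 more.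
  linear_combination (norm := module) k1 + m1 - m2 + m3 - m4 + (3 : BiPoly K) • k2 +
    (3 : BiPoly K) • k3 - (2 : BiPoly K) • Q • hp i j k l

end Module

end

end Koszul

/-! ### Linear dependences between the generic vectors and between their products -/

namespace Koszul

open MvPolynomial

noncomputable section

variable {K : Type*} [Field K]

/-- The entry in position `(0, 1)` of the generic value of a generator, as a linear form: the
coordinate `inl j` belongs to `y j`, and `inr i` belongs to `z i`. -/
def vec : ℕ ⊕ (ℕ × ℕ) → (ℕ ⊕ ℕ →₀ BiPoly K)
  | .inl i => Finsupp.single (.inr i) 1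
  | .inr (i, j) => Finsupp.single (.inl j) (t i) - Finsupp.single (.inl i) (t j)

section Module

variable [CharZero K] {N : Type*} [AddCommGroup N] [Module K N] [Module (BiPoly K) N]
  [IsScalarTower K (BiPoly K) N]

/-- Linear dependences between the `vec X` hold in every module with alternating elements
`gen (inr (i, j))` that satisfy the Koszul relations. -/
theorem linearCombination_eq_zero {gen : ℕ ⊕ (ℕ × ℕ) → N}
    (hc : ∀ i j p, (t i : BiPoly K) • gen (.inr (p, j)) - (t j : BiPoly K) • gen (.inr (p, i)) =
      (t p : BiPoly K) • gen (.inr (i, j)))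
    (ha : ∀ i j, gen (.inr (j, i)) = - gen (.inr (i, j))) {x : ℕ ⊕ (ℕ × ℕ) →₀ BiPoly K}
    (hx : Finsupp.linearCombination (BiPoly K) (vec (K := K)) x = 0) :
    Finsupp.linearCombination (BiPoly K) gen x = 0 := by
  -- A map, only K-linear, that sends r • vec X to r • gen X; it carries every dependence over.
  let s : (ℕ ⊕ ℕ →₀ BiPoly K) →ₗ[K] N := Finsupp.lsum K fun v => match v with
    | .inl j => (polar (fun p q => gen (.inr (p, q))) j).toLinearMap ∘ₗ normOne
    | .inr i => (LinearMap.toSpanSingleton (BiPoly K) N (gen (.inl i))).restrictScalars K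
  have hl : ∀ j r, s (Finsupp.single (.inl j) r) =
      polar (fun p q => gen (.inr (p, q))) j (normOne r) := by
    intro j r
    simp only [s, Finsupp.lsum_single]
    rfl
  have hr : ∀ i r, s (Finsupp.single (.inr i) r) = r • gen (.inl i) := by
    intro j r
    simp only [s, Finsupp.lsum_single]
    rfl
  have key : ∀ x, s (Finsupp.linearCombination (BiPoly K) (vec (K := K)) x) =
      Finsupp.linearCombination (BiPoly K) gen x := by
    intro x
    induction x using Finsupp.induction_linear with
    | zero => simp
    | add v w hv hw => simp only [map_add, hv, hw]
    | single X r =>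
      rw [Finsupp.linearCombination_single, Finsupp.linearCombination_single]
      rcases X with i | ⟨i, j⟩
      · rw [vec, Finsupp.smul_single, smul_eq_mul, mul_one, hr]
      · rw [vec, smul_sub, Finsupp.smul_single, Finsupp.smul_single, map_sub, hl, hl, smul_eq_mul,
          smul_eq_mul]
        exact polar_section hc ha i j r
  rw [← key, hx, map_zero]

/-- The outer product of two vectors. -/
def outer : (ℕ ⊕ ℕ →₀ BiPoly K) →ₗ[BiPoly K] (ℕ ⊕ ℕ →₀ BiPoly K) →ₗ[BiPoly K]
    ((ℕ ⊕ ℕ) × (ℕ ⊕ ℕ) →₀ BiPoly K) :=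
  Finsupp.linearCombination (BiPoly K) fun k => Finsupp.lmapDomain (BiPoly K) (BiPoly K) (Prod.mk k)

omit [CharZero K] in
theorem outer_single (k l : ℕ ⊕ ℕ) (r s : BiPoly K) :
    outer (Finsupp.single k r) (Finsupp.single l s) = Finsupp.single (k, l) (r * s) := by
  rw [outer, Finsupp.linearCombination_single, LinearMap.smul_apply, Finsupp.lmapDomain_apply,
    Finsupp.mapDomain_single, Finsupp.smul_single, smul_eq_mul]

omit [CharZero K] in
theorem outer_apply (v w : ℕ ⊕ ℕ →₀ BiPoly K) (k l : ℕ ⊕ ℕ) : outer v w (k, l) = v k * w l := by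
  induction v using Finsupp.induction_linear with
  | zero => simp
  | add a b ha hb => rw [map_add, LinearMap.add_apply, Finsupp.add_apply, ha, hb,
      Finsupp.add_apply, add_mul]
  | single i r =>
    induction w using Finsupp.induction_linear with
    | zero => simp
    | add a b ha hb => rw [map_add, Finsupp.add_apply, ha, hb, Finsupp.add_apply, mul_add]
    | single j s =>
      rw [outer_single]
      simp only [Finsupp.single_apply, Prod.mk.injEq]
      split_ifs <;> simp_all

/-- The symmetrised outer product of the vectors of two generators. -/
def vecTwo (X : (ℕ ⊕ (ℕ × ℕ)) × (ℕ ⊕ (ℕ × ℕ))) : (ℕ ⊕ ℕ) × (ℕ ⊕ ℕ) →₀ BiPoly K :=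
  outer (vec X.1) (vec X.2) + outer (vec X.2) (vec X.1)

/-- Linear dependences between the symmetrised products of the `vec X` hold in every module with
elements `gen X Y` that are symmetric and satisfy the Koszul and the Plücker relations. -/
theorem linearCombination_two_eq_zero {gen : ℕ ⊕ (ℕ × ℕ) → ℕ ⊕ (ℕ × ℕ) → N}
    (hc : ∀ i j p Y, (t i : BiPoly K) • gen (.inr (p, j)) Y -
      (t j : BiPoly K) • gen (.inr (p, i)) Y =
      (t p : BiPoly K) • gen (.inr (i, j)) Y)
    (ha : ∀ i j Y, gen (.inr (j, i)) Y = - gen (.inr (i, j)) Y)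
    (hsym : ∀ X Y, gen X Y = gen Y X)
    (hp : ∀ i j k l, gen (.inr (i, j)) (.inr (k, l)) - gen (.inr (i, k)) (.inr (j, l)) +
      gen (.inr (i, l)) (.inr (j, k)) = 0)
    {x : (ℕ ⊕ (ℕ × ℕ)) × (ℕ ⊕ (ℕ × ℕ)) →₀ BiPoly K}
    (hx : Finsupp.linearCombination (BiPoly K) (vecTwo (K := K)) x = 0) :
    Finsupp.linearCombination (BiPoly K) (fun X => gen X.1 X.2) x = 0 := by
  let c : ℕ → ℕ → ℕ → ℕ → N := fun i j k l => gen (.inr (i, j)) (.inr (k, l))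
  -- A symmetrised product contains each mixed term in both orders, so one order may be sent to
  -- zero. Where both coordinates have the same kind, both orders contribute equally, whence the
  -- factor 1/2.
  let s : ((ℕ ⊕ ℕ) × (ℕ ⊕ ℕ) →₀ BiPoly K) →ₗ[K] N := Finsupp.lsum K fun v => match v with
    | (.inl j, .inl l) => (2 : K)⁻¹ • (polarTwo c j l ∘ₗ normTwo)
    | (.inl _, .inr _) => 0
    | (.inr i, .inl l) => (polar (fun p q => gen (.inr (p, q)) (.inl i)) l).toLinearMap ∘ₗ normOne
    | (.inr i, .inr j) =>
      (2 : K)⁻¹ • (LinearMap.toSpanSingleton (BiPoly K) N (gen (.inl i) (.inl j))).restrictScalars K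
  have hll : ∀ j l r, s (Finsupp.single (.inl j, .inl l) r) =
      (2 : K)⁻¹ • polarTwo c j l (normTwo r) := by
    intro j l r
    simp only [s, Finsupp.lsum_single]
    rfl
  have hlr : ∀ j l r, s (Finsupp.single (.inl j, .inr l) r) = 0 := by
    intro j l r
    simp only [s, Finsupp.lsum_single]
    rfl
  have hrl : ∀ i l r, s (Finsupp.single (.inr i, .inl l) r) =
      polar (fun p q => gen (.inr (p, q)) (.inl i)) l (normOne r) := by
    intro j l r
    simp only [s, Finsupp.lsum_single]
    rfl
  have hrr : ∀ i l r, s (Finsupp.single (.inr i, .inr l) r) =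
      (2 : K)⁻¹ • r • gen (.inl i) (.inl l) := by
    intro j l r
    simp only [s, Finsupp.lsum_single]
    rfl
  have half : ∀ n : N, (2 : K)⁻¹ • n + (2 : K)⁻¹ • n = n := by
    intro n
    rw [← two_smul K, smul_smul, mul_inv_cancel₀ two_ne_zero, one_smul]
  have hmixed : ∀ (r : BiPoly K) i k l, s (r • outer (vec (.inl i)) (vec (.inr (k, l)))) +
      s (r • outer (vec (.inr (k, l))) (vec (.inl i))) = r • gen (.inr (k, l)) (.inl i) := by
    intro r i k l
    simp only [vec, map_sub, LinearMap.sub_apply, outer_single, smul_sub, Finsupp.smul_single,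
      smul_eq_mul, hlr, hrl, sub_zero, add_zero, one_mul]
    exact polar_section (fun a b p => hc a b p _) (fun a b => ha a b _) k l r
  have hbracket : ∀ (r : BiPoly K) i j k l,
      s (r • outer (vec (.inr (i, j))) (vec (.inr (k, l)))) =
        (2 : K)⁻¹ • r • gen (.inr (i, j)) (.inr (k, l)) := by
    intro r i j k l
    simp only [vec, map_sub, LinearMap.sub_apply, outer_single, smul_sub, Finsupp.smul_single,
      smul_eq_mul, hll]
    have h := polarTwo_section (c := c) (fun a b p d e => hc a b p _) (fun a b d e => ha a b _)
      (fun a b d e => hsym _ _) (fun a b d e => hp a b d e) i j k l r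
    rw [← h]
    simp only [smul_add, smul_sub, mul_assoc]
    abel
  have key : ∀ x, s (Finsupp.linearCombination (BiPoly K) (vecTwo (K := K)) x) =
      Finsupp.linearCombination (BiPoly K) (fun X => gen X.1 X.2) x := by
    intro x
    induction x using Finsupp.induction_linear with
    | zero => simp
    | add v w hv hw => simp only [map_add, hv, hw]
    | single X r =>
      rw [Finsupp.linearCombination_single, Finsupp.linearCombination_single, vecTwo, smul_add,
        map_add]
      obtain ⟨i | ⟨i, j⟩, k | ⟨k, l⟩⟩ := X
      · simp only [vec, outer_single, Finsupp.smul_single, smul_eq_mul, mul_one, hrr]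
        rw [hsym (.inl k), half]
      · rw [hsym]
        exact hmixed r i k l
      · rw [add_comm]
        exact hmixed r k i j
      · rw [hbracket, hbracket, hsym (.inr (k, l)), half]
  rw [← key, hx, map_zero]

end Module

end

end Koszul

/-! ### Polynomial actions on maps into quotients of the free algebra -/

namespace StarPoly

open Koszul

noncomputable section

variable {K : Type*} [Field K]

section BiHom

variable {W : Type*} [Ring W] [Algebra K W] (ρ : StarPoly K →ₐ[K] W)

/-- The linear maps into `W` that vanish on the kernel of `commPart`, and whose values are
annihilated by it. -/
def biHomSubmodule : Submodule K (StarPoly K →ₗ[K] W) where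
  carrier := {h | ∀ x, commPart x = 0 → h x = 0 ∧ ∀ v, ρ x * h v = 0}
  add_mem' := by
    intro a b ha hb x hx
    refine ⟨by rw [LinearMap.add_apply, (ha x hx).1, (hb x hx).1, add_zero], fun v => ?_⟩
    rw [LinearMap.add_apply, mul_add, (ha x hx).2, (hb x hx).2, add_zero]
  zero_mem' := fun _ _ => ⟨rfl, fun _ => mul_zero _⟩
  smul_mem' := by
    intro r a ha x hx
    refine ⟨by rw [LinearMap.smul_apply, (ha x hx).1, smul_zero], fun v => ?_⟩
    rw [LinearMap.smul_apply, mul_smul_comm, (ha x hx).2, smul_zero]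

/-- The type of the elements of `biHomSubmodule`. It carries commuting left multiplications of the
values and of the arguments by the variables `y i`, hence the structure of a module over the
polynomials in two sequences of variables. -/
def BiHom : Type _ := biHomSubmodule ρ

namespace BiHom

instance : AddCommGroup (BiHom ρ) := inferInstanceAs (AddCommGroup (biHomSubmodule ρ))

instance : Module K (BiHom ρ) := inferInstanceAs (Module K (biHomSubmodule ρ))

variable {ρ}

/-- The value of an element of `BiHom ρ`. -/
def app (v : StarPoly K) : BiHom ρ →ₗ[K] W where
  toFun h := h.1 v
  map_add' _ _ := rfl
  map_smul' _ _ := rfl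

theorem ext {h h' : BiHom ρ} (H : ∀ v, app v h = app v h') : h = h' :=
  Subtype.ext (LinearMap.ext H)

/-- An element of `BiHom ρ` from a linear map. -/
def mk (h : StarPoly K →ₗ[K] W) (hh : ∀ x, commPart x = 0 → h x = 0 ∧ ∀ v, ρ x * h v = 0) :
    BiHom ρ := ⟨h, hh⟩

theorem app_add (v w : StarPoly K) (h : BiHom ρ) : app (v + w) h = app v h + app w h :=
  map_add h.1 v w

theorem app_smul (r : K) (v : StarPoly K) (h : BiHom ρ) : app (r • v) h = r • app v h :=
  map_smul h.1 r v

theorem app_eq_zero {x : StarPoly K} (hx : commPart x = 0) (h : BiHom ρ) : app x h = 0 :=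
  (h.2 x hx).1

theorem mul_app_eq_zero {x : StarPoly K} (hx : commPart x = 0) (v : StarPoly K) (h : BiHom ρ) :
    ρ x * app v h = 0 :=
  (h.2 x hx).2 v

/-- Left multiplication of the values by `y i`. -/
def left (i : ℕ) : Module.End K (BiHom ρ) where
  toFun h := mk (LinearMap.mulLeft K (ρ (y K i)) ∘ₗ h.1) (by
    intro x hx
    refine ⟨?_, fun v => ?_⟩
    · change ρ (y K i) * app x h = 0
      rw [app_eq_zero hx, mul_zero]
    · change ρ x * (ρ (y K i) * app v h) = 0
      rw [← mul_assoc, ← map_mul, mul_app_eq_zero (by rw [map_mul, hx, zero_mul])])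
  map_add' _ _ := ext fun _ => mul_add _ _ _
  map_smul' _ _ := ext fun _ => mul_smul_comm _ _ _

/-- Left multiplication of the arguments by `y i`. -/
def right (i : ℕ) : Module.End K (BiHom ρ) where
  toFun h := mk (h.1 ∘ₗ LinearMap.mulLeft K (y K i)) (by
    intro x hx
    refine ⟨?_, fun v => ?_⟩
    · change app (y K i * x) h = 0
      rw [app_eq_zero (by rw [map_mul, hx, mul_zero])]
    · exact mul_app_eq_zero hx (y K i * v) h)
  map_add' _ _ := rfl
  map_smul' _ _ := rfl

theorem app_left (i : ℕ) (v : StarPoly K) (h : BiHom ρ) :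
    app v (left i h) = ρ (y K i) * app v h := rfl

theorem app_right (i : ℕ) (v : StarPoly K) (h : BiHom ρ) :
    app v (right i h) = app (y K i * v) h := rfl

theorem left_mul_left (i j : ℕ) : left (ρ := ρ) i * left j = left j * left i := by
  refine LinearMap.ext fun h => ext fun v => ?_
  simp only [Module.End.mul_apply, app_left]
  rw [← sub_eq_zero, ← mul_assoc, ← mul_assoc, ← sub_mul, ← map_mul, ← map_mul, ← map_sub]
  exact mul_app_eq_zero (commPart_skewGen (.inr (i, j))) v h

theorem right_mul_right (i j : ℕ) : right (ρ := ρ) i * right j = right j * right i := by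
  refine LinearMap.ext fun h => ext fun v => ?_
  simp only [Module.End.mul_apply, app_right]
  have h1 : app (y K j * (y K i * v) - y K i * (y K j * v)) h = 0 :=
    app_eq_zero (by rw [map_sub, map_mul, map_mul, map_mul, map_mul, mul_left_comm, sub_self]) h
  exact sub_eq_zero.1 (((map_sub h.1 _ _).symm).trans h1)

theorem left_mul_right (i j : ℕ) : left (ρ := ρ) i * right j = right j * left i := rfl

/-- `g i` multiplies the argument by y_i, and `t i` acts as a commutator with y_i, matching the
difference of the diagonal entries of a generic matrix. The operators commute because [y_i, y_j]
lies in the kernel of `commPart`, which acts as zero on both sides. -/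
theorem exists_action : ∃ Ψ : BiPoly K →ₐ[K] Module.End K (BiHom ρ),
    ∀ v, Ψ (MvPolynomial.X v) = Sum.elim (fun i => left i - right i) right v := by
  refine MvPolynomial.exists_algHom_of_commute _ ?_
  rintro (i | i) (j | j)
  · simp only [Sum.elim_inl, sub_mul, mul_sub, left_mul_left i j, right_mul_right i j,
      left_mul_right]
    abel
  · simp only [Sum.elim_inl, Sum.elim_inr, sub_mul, mul_sub, right_mul_right i j, left_mul_right]
  · simp only [Sum.elim_inl, Sum.elim_inr, sub_mul, mul_sub, right_mul_right i j, left_mul_right]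
  · exact right_mul_right i j

/-- The action of the polynomials in two sequences of variables on `BiHom ρ`. -/
def action : BiPoly K →ₐ[K] Module.End K (BiHom ρ) := exists_action.choose

instance : Module (BiPoly K) (BiHom ρ) := Module.compHom _ (action (ρ := ρ)).toRingHom

theorem smul_def (P : BiPoly K) (h : BiHom ρ) : P • h = action P h := rfl

instance : IsScalarTower K (BiPoly K) (BiHom ρ) :=
  ⟨fun r P h => by rw [smul_def, map_smul]; rfl⟩

theorem g_smul (i : ℕ) (h : BiHom ρ) : (g i : BiPoly K) • h = right i h := by
  rw [smul_def, action, g, exists_action.choose_spec]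
  rfl

theorem t_smul (i : ℕ) (h : BiHom ρ) : (t i : BiPoly K) • h = left i h - right i h := by
  rw [smul_def, action, t, exists_action.choose_spec]
  rfl

theorem C_smul (r : K) (h : BiHom ρ) : (algebraMap K (BiPoly K) r) • h = r • h :=
  algebraMap_smul _ _ _

theorem app_t_smul (i : ℕ) (v : StarPoly K) (h : BiHom ρ) :
    app v ((t i : BiPoly K) • h) = ρ (y K i) * app v h - app (y K i * v) h := by
  rw [t_smul, map_sub, app_left, app_right]

/-- The homomorphism `y i ↦ g i`, `z i ↦ 0`. -/
def innerPart : StarPoly K →ₐ[K] BiPoly K := (MvPolynomial.aeval g).comp commPart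

/-- The homomorphism `y i ↦ t i + g i`, `z i ↦ 0`. -/
def outerPart : StarPoly K →ₐ[K] BiPoly K :=
  (MvPolynomial.aeval fun i => t i + g i).comp commPart

theorem innerPart_y (i : ℕ) : innerPart (y K i) = g i := by
  rw [innerPart, AlgHom.comp_apply, commPart_y, MvPolynomial.aeval_X]

theorem outerPart_y (i : ℕ) : outerPart (y K i) = t i + g i := by
  rw [outerPart, AlgHom.comp_apply, commPart_y, MvPolynomial.aeval_X]

theorem innerPart_eq_zero {f : StarPoly K} (hf : commPart f = 0) : innerPart f = 0 := by
  rw [innerPart, AlgHom.comp_apply, hf, map_zero]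

theorem outerPart_eq_zero {f : StarPoly K} (hf : commPart f = 0) : outerPart f = 0 := by
  rw [outerPart, AlgHom.comp_apply, hf, map_zero]

theorem app_innerPart_smul (u v : StarPoly K) (h : BiHom ρ) :
    app v (innerPart u • h) = app (u * v) h := by
  induction u using StarPoly.induction generalizing v h with
  | hC r => rw [AlgHom.commutes, C_smul, map_smul, ← Algebra.smul_def, app_smul]
  | hy i => rw [innerPart_y, g_smul, app_right]
  | hz i =>
    rw [innerPart_eq_zero (commPart_z i), zero_smul, map_zero,
      app_eq_zero (by rw [map_mul, commPart_z, zero_mul])]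
  | hmul a b ha hb => rw [map_mul, mul_comm, mul_smul, hb, ha, mul_assoc]
  | hadd a b ha hb => rw [map_add, add_smul, map_add, ha, hb, add_mul, app_add]

theorem app_outerPart_smul (u v : StarPoly K) (h : BiHom ρ) :
    app v (outerPart u • h) = ρ u * app v h := by
  induction u using StarPoly.induction generalizing v h with
  | hC r => rw [AlgHom.commutes, C_smul, map_smul, AlgHom.commutes, ← Algebra.smul_def]
  | hy i => rw [outerPart_y, add_smul, g_smul, t_smul, sub_add_cancel, app_left]
  | hz i =>
    rw [outerPart_eq_zero (commPart_z i), zero_smul, map_zero, mul_app_eq_zero (commPart_z i)]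
  | hmul a b ha hb => rw [map_mul, mul_smul, ha, hb, map_mul, mul_assoc]
  | hadd a b ha hb => rw [map_add, add_smul, map_add, ha, hb, map_add, add_mul]

end BiHom

end BiHom

open BiHom

/-! ### Generic matrices in `A` -/

section Generic

/-- The generic evaluation at elements of `A` with zero entries in the corner. -/
def generic (w : ℕ ⊕ ℕ → BiPoly K) : StarPoly K →ₐ[K] Matrix (Fin 3) (Fin 3) (BiPoly K) :=
  eval K (fun i => !![t i + g i, w (.inl i), 0; 0, g i, w (.inl i); 0, 0, t i + g i])
    (fun i => !![0, w (.inr i), 0; 0, 0, -w (.inr i); 0, 0, 0])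

theorem generic_shape (w : ℕ ⊕ ℕ → BiPoly K) (f : StarPoly K) :
    ∃ a b c, generic w f = !![outerPart f, a, c; 0, innerPart f, b; 0, 0, outerPart f] := by
  induction f using StarPoly.induction with
  | hC r =>
    refine ⟨0, 0, 0, ?_⟩
    rw [AlgHom.commutes, AlgHom.commutes, AlgHom.commutes]
    ext1 i j
    fin_cases i <;> fin_cases j <;> simp [Matrix.algebraMap_matrix_apply]
  | hy i => exact ⟨w (.inl i), w (.inl i), 0, by rw [generic, eval_y, outerPart_y, innerPart_y]⟩
  | hz i =>
    refine ⟨w (.inr i), -w (.inr i), 0, ?_⟩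
    rw [generic, eval_z, outerPart_eq_zero (commPart_z i), innerPart_eq_zero (commPart_z i)]
  | hmul f f' h h' =>
    obtain ⟨a, b, c, h⟩ := h
    obtain ⟨a', b', c', h'⟩ := h'
    refine ⟨outerPart f * a' + a * innerPart f', innerPart f * b' + b * outerPart f',
      outerPart f * c' + a * b' + c * outerPart f', ?_⟩
    rw [map_mul, map_mul, map_mul, h, h']
    ext1 i j
    fin_cases i <;> fin_cases j <;> simp [add_assoc]
  | hadd f f' h h' =>
    obtain ⟨a, b, c, h⟩ := h
    obtain ⟨a', b', c', h'⟩ := h'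
    refine ⟨a + a', b + b', c + c', ?_⟩
    rw [map_add, map_add, map_add, h, h']
    ext1 i j
    fin_cases i <;> fin_cases j <;> simp

theorem generic_skewGen (w : ℕ ⊕ ℕ → BiPoly K) (X : ℕ ⊕ (ℕ × ℕ)) :
    ∃ c, generic w (skewGen X) =
      !![0, Finsupp.linearCombination (BiPoly K) w (vec X), c;
        0, 0, -Finsupp.linearCombination (BiPoly K) w (vec X); 0, 0, 0] := by
  rcases X with i | ⟨i, j⟩
  · refine ⟨0, ?_⟩
    rw [vec, Finsupp.linearCombination_single, one_smul, skewGen, generic, eval_z]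
  · refine ⟨0, ?_⟩
    rw [vec, map_sub, Finsupp.linearCombination_single, Finsupp.linearCombination_single, skewGen,
      map_sub, map_mul, map_mul, generic, eval_y, eval_y]
    ext1 k l
    fin_cases k <;> fin_cases l <;> simp <;> ring

theorem generic_one_skewGen (w : ℕ ⊕ ℕ → BiPoly K) (X : ℕ ⊕ (ℕ × ℕ)) (u v : StarPoly K) :
    generic w (u * skewGen X * v) 0 1 =
      outerPart u * Finsupp.linearCombination (BiPoly K) w (vec X) * innerPart v := by
  obtain ⟨a, b, c, hu⟩ := generic_shape w u
  obtain ⟨a', b', c', hv⟩ := generic_shape w v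
  obtain ⟨d, hX⟩ := generic_skewGen w X
  rw [map_mul, map_mul, hu, hv, hX]
  simp

theorem generic_two_skewGen (w : ℕ ⊕ ℕ → BiPoly K) (X Y : ℕ ⊕ (ℕ × ℕ)) (u m v : StarPoly K) :
    generic w (u * skewGen X * m * skewGen Y * v) 0 2 =
      -(outerPart u * Finsupp.linearCombination (BiPoly K) w (vec X) * innerPart m *
        Finsupp.linearCombination (BiPoly K) w (vec Y) * outerPart v) := by
  obtain ⟨a, b, c, hu⟩ := generic_shape w u
  obtain ⟨a', b', c', hv⟩ := generic_shape w v
  obtain ⟨a'', b'', c'', hm⟩ := generic_shape w m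
  obtain ⟨d, hX⟩ := generic_skewGen w X
  obtain ⟨e, hY⟩ := generic_skewGen w Y
  rw [map_mul, map_mul, map_mul, map_mul, hu, hv, hX, hm, hY]
  simp

/-- Every specialisation of the generic matrices lies in `A` with the right symmetry, and a
polynomial over an infinite field is determined by its values. -/
theorem generic_eq_zero [CharZero K] (w : ℕ ⊕ ℕ → BiPoly K) {f : StarPoly K}
    (hf : f ∈ identities K (invA K)) : generic w f = 0 := by
  ext1 i j
  refine MvPolynomial.funext fun x => ?_
  let u : ℕ → algA K := fun n =>
    ⟨!![x (.inl n) + x (.inr n), MvPolynomial.eval x (w (.inl n)), 0;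
      0, x (.inr n), MvPolynomial.eval x (w (.inl n)); 0, 0, x (.inl n) + x (.inr n)],
      _, _, _, _, _, rfl⟩
  let v : ℕ → algA K := fun n =>
    ⟨!![0, MvPolynomial.eval x (w (.inr n)), 0; 0, 0, -MvPolynomial.eval x (w (.inr n)); 0, 0, 0],
      _, _, _, _, _, rfl⟩
  have key : ∀ f : StarPoly K,
      (generic w f).map (MvPolynomial.eval x) = (StarPoly.eval K u v f).1 := by
    intro f
    induction f using StarPoly.induction with
    | hC r =>
      rw [AlgHom.commutes, AlgHom.commutes]
      ext1 k l
      simp only [Matrix.map_apply, Matrix.algebraMap_matrix_apply, Subalgebra.coe_algebraMap,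
        MvPolynomial.algebraMap_eq, Algebra.algebraMap_self, RingHom.id_apply]
      split_ifs <;> simp
    | hy n =>
      rw [generic, eval_y, eval_y]
      ext1 k l
      fin_cases k <;> fin_cases l <;> simp [u, t, g]
    | hz n =>
      rw [generic, eval_z, eval_z]
      ext1 k l
      fin_cases k <;> fin_cases l <;> simp [v]
    | hmul a b ha hb => rw [map_mul, map_mul, Matrix.map_mul, ha, hb]; rfl
    | hadd a b ha hb =>
      rw [map_add, map_add, Matrix.map_add _ (fun a b => map_add _ a b), ha, hb]; rfl
  have hu : ∀ n, (invA K).IsSymm (u n) := fun n => Subtype.ext (reflect_eq _ _ _ _ _)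
  have hv : ∀ n, (invA K).IsSkew (v n) := by
    intro n
    refine Subtype.ext ((reflect_eq _ _ _ _ _).trans ?_)
    ext1 k l
    fin_cases k <;> fin_cases l <;> simp [v]
  have h := key f
  rw [hf u v hu hv] at h
  have h2 := congrFun (congrFun h i) j
  rw [Matrix.map_apply] at h2
  rw [h2]
  simp

end Generic

end

end StarPoly

/-! ### Coefficients from generic values, and the two layers -/

namespace StarPoly

open Koszul BiHom

noncomputable section

variable {K : Type*} [Field K]

/-- The pairing of a matrix of coefficients with two vectors. -/
def pairing (w w' : ℕ ⊕ ℕ → BiPoly K) : ((ℕ ⊕ ℕ) × (ℕ ⊕ ℕ) →₀ BiPoly K) →ₗ[BiPoly K] BiPoly K :=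
  Finsupp.linearCombination (BiPoly K) fun v => w v.1 * w' v.2

theorem pairing_outer (w w' : ℕ ⊕ ℕ → BiPoly K) (v v' : ℕ ⊕ ℕ →₀ BiPoly K) :
    pairing w w' (outer v v') = Finsupp.linearCombination (BiPoly K) w v *
      Finsupp.linearCombination (BiPoly K) w' v' := by
  induction v using Finsupp.induction_linear with
  | zero => simp
  | add a b ha hb => rw [map_add, LinearMap.add_apply, map_add, ha, hb, map_add, add_mul]
  | single i r =>
    induction v' using Finsupp.induction_linear with
    | zero => simp
    | add a b ha hb => rw [map_add, map_add, ha, hb, map_add, mul_add]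
    | single j s =>
      rw [outer_single, pairing, Finsupp.linearCombination_single,
        Finsupp.linearCombination_single, Finsupp.linearCombination_single]
      simp only [smul_eq_mul]
      ring

theorem pairing_add (w w' : ℕ ⊕ ℕ → BiPoly K) (y : (ℕ ⊕ ℕ) × (ℕ ⊕ ℕ) →₀ BiPoly K) :
    pairing (w + w') (w + w') y =
      pairing w w y + pairing w w' y + pairing w' w y + pairing w' w' y := by
  induction y using Finsupp.induction_linear with
  | zero => simp
  | add a b ha hb => rw [map_add, ha, hb, map_add, map_add, map_add, map_add]; abel
  | single v r =>
    simp only [pairing, Finsupp.linearCombination_single, Pi.add_apply, smul_eq_mul]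
    ring

theorem linearCombination_pi_single_one (k : ℕ ⊕ ℕ) (y : ℕ ⊕ ℕ →₀ BiPoly K) :
    Finsupp.linearCombination (BiPoly K) (Pi.single k (1 : BiPoly K)) y = y k := by
  induction y using Finsupp.induction_linear with
  | zero => simp
  | add a b ha hb => rw [map_add, ha, hb, Finsupp.add_apply]
  | single v r =>
    simp only [Finsupp.linearCombination_single, Pi.single_apply, smul_eq_mul,
      Finsupp.single_apply]
    split_ifs <;> simp_all

theorem pairing_single_one (k l : ℕ ⊕ ℕ) (y : (ℕ ⊕ ℕ) × (ℕ ⊕ ℕ) →₀ BiPoly K) :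
    pairing (Pi.single k 1) (Pi.single l 1) y = y (k, l) := by
  induction y using Finsupp.induction_linear with
  | zero => simp
  | add a b ha hb => rw [map_add, ha, hb, Finsupp.add_apply]
  | single v r =>
    obtain ⟨a, b⟩ := v
    simp only [pairing, Finsupp.linearCombination_single, Pi.single_apply, smul_eq_mul,
      Finsupp.single_apply, Prod.mk.injEq]
    split_ifs <;> simp_all

/-- Polarisation: at the sum of the k-th and l-th unit vectors the quadratic form yields 2 y(k, l).
-/
theorem eq_zero_of_pairing [CharZero K] {y : (ℕ ⊕ ℕ) × (ℕ ⊕ ℕ) →₀ BiPoly K}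
    (hsym : ∀ k l, y (k, l) = y (l, k)) (h : ∀ w, pairing w w y = 0) : y = 0 := by
  ext1 ⟨k, l⟩
  have h1 := h (Pi.single k 1 + Pi.single l 1)
  rw [pairing_add, h, h, pairing_single_one, pairing_single_one, hsym l k, zero_add, add_zero,
    ← two_mul] at h1
  exact (mul_eq_zero.1 h1).resolve_left two_ne_zero

theorem linearCombination_vecTwo_symm (x : (ℕ ⊕ (ℕ × ℕ)) × (ℕ ⊕ (ℕ × ℕ)) →₀ BiPoly K)
    (k l : ℕ ⊕ ℕ) : Finsupp.linearCombination (BiPoly K) (vecTwo (K := K)) x (k, l) =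
      Finsupp.linearCombination (BiPoly K) (vecTwo (K := K)) x (l, k) := by
  induction x using Finsupp.induction_linear with
  | zero => simp
  | add a b ha hb => rw [map_add, Finsupp.add_apply, Finsupp.add_apply, ha, hb]
  | single X r =>
    rw [Finsupp.linearCombination_single, Finsupp.smul_apply, Finsupp.smul_apply, vecTwo,
      Finsupp.add_apply, Finsupp.add_apply, outer_apply, outer_apply, outer_apply, outer_apply,
      smul_eq_mul, smul_eq_mul]
    ring

section Linear

variable (J : TwoSidedIdeal (StarPoly K))

/-- The ideal generated by `J` and the square of the kernel of `commPart`. -/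
def squareIdeal : TwoSidedIdeal (StarPoly K) :=
  TwoSidedIdeal.span ({f | ∃ a b, commPart a = 0 ∧ commPart b = 0 ∧ f = a * b} ∪ J)

theorem mul_mem_squareIdeal {a b : StarPoly K} (ha : commPart a = 0) (hb : commPart b = 0) :
    a * b ∈ squareIdeal J :=
  TwoSidedIdeal.subset_span (Or.inl ⟨a, b, ha, hb, rfl⟩)

/-- Right multiplication of a generator, with values modulo `squareIdeal J`. -/
def mulMap (X : ℕ ⊕ (ℕ × ℕ)) : BiHom ((squareIdeal J).quotientAlgHom (K := K)) :=
  .mk (((squareIdeal J).quotientAlgHom (K := K)).toLinearMap ∘ₗ LinearMap.mulLeft K (skewGen X)) (by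
    intro x hx
    refine ⟨?_, fun v => ?_⟩
    · exact ((squareIdeal J).quotientAlgHom_eq_zero_iff (K := K) _).2
        (mul_mem_squareIdeal J (commPart_skewGen X) hx)
    · change (squareIdeal J).quotientAlgHom (K := K) x *
        (squareIdeal J).quotientAlgHom (K := K) (skewGen X * v) = 0
      rw [← map_mul, TwoSidedIdeal.quotientAlgHom_eq_zero_iff]
      exact mul_mem_squareIdeal J hx (by rw [map_mul, commPart_skewGen, zero_mul]))

theorem app_mulMap (X : ℕ ⊕ (ℕ × ℕ)) (v : StarPoly K) :
    app v (mulMap J X) = (squareIdeal J).quotientAlgHom (K := K) (skewGen X * v) := rfl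

/-- Since `t i` turns X v into [y_i, X] v, this is the Jacobi identity for y_i, y_j, y_p. -/
theorem mulMap_koszul (i j p : ℕ) : (t i : BiPoly K) • mulMap J (.inr (p, j)) -
    (t j : BiPoly K) • mulMap J (.inr (p, i)) = (t p : BiPoly K) • mulMap J (.inr (i, j)) := by
  refine BiHom.ext fun v => ?_
  rw [map_sub, app_t_smul, app_t_smul, app_t_smul]
  simp only [app_mulMap, ← map_mul, ← map_sub]
  congr 1
  simp only [skewGen]
  noncomm_ring

theorem mulMap_anti (i j : ℕ) : mulMap J (.inr (j, i)) = - mulMap J (.inr (i, j)) := by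
  refine BiHom.ext fun v => ?_
  rw [map_neg]
  simp only [app_mulMap, ← map_neg]
  congr 1
  simp only [skewGen]
  noncomm_ring

/-- The same coefficients x describe both the class of f modulo I² + J and its (0,1) entry, so a
vanishing entry can be transferred to the class. -/
theorem exists_linear_presentation {f : StarPoly K} (hf : commPart f = 0) :
    ∃ x : ℕ ⊕ (ℕ × ℕ) →₀ BiPoly K,
      app 1 (Finsupp.linearCombination (BiPoly K) (mulMap J) x) =
        (squareIdeal J).quotientAlgHom (K := K) f ∧
      ∀ w, Finsupp.linearCombination (BiPoly K) w
        (Finsupp.linearCombination (BiPoly K) vec x) = generic w f 0 1 := by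
  refine commPart_ker_induction (p := fun f => ∃ x : ℕ ⊕ (ℕ × ℕ) →₀ BiPoly K,
      app 1 (Finsupp.linearCombination (BiPoly K) (mulMap J) x) =
        (squareIdeal J).quotientAlgHom (K := K) f ∧
      ∀ w, Finsupp.linearCombination (BiPoly K) w
        (Finsupp.linearCombination (BiPoly K) vec x) = generic w f 0 1) ?_ ?_ hf
  · rintro a b ⟨x, hx, hx'⟩ ⟨y, hy, hy'⟩
    refine ⟨x + y, by rw [map_add, map_add, map_add, hx, hy], fun w => ?_⟩
    rw [map_add, map_add, map_add, hx', hy', Matrix.add_apply]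
  · intro u X v
    refine ⟨Finsupp.single X (outerPart u * innerPart v), ?_, fun w => ?_⟩
    · rw [Finsupp.linearCombination_single, mul_smul, app_outerPart_smul, app_innerPart_smul,
        app_mulMap, ← map_mul, mul_one, mul_assoc]
    · rw [Finsupp.linearCombination_single, map_smul, generic_one_skewGen, smul_eq_mul]
      ring

theorem mem_squareIdeal [CharZero K] {f : StarPoly K} (hf : ∀ w, generic w f = 0) :
    f ∈ squareIdeal J := by
  -- The middle diagonal entry is `commPart f` with its variables renamed injectively.
  have hc : commPart f = 0 := by
    obtain ⟨a, b, c, h⟩ := generic_shape 0 f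
    rw [hf] at h
    have h1 : innerPart f = 0 := (congrFun (congrFun h 1) 1).symm
    have h2 : innerPart f = MvPolynomial.rename (R := K) Sum.inr (commPart f) := by
      have h3 : (MvPolynomial.aeval g : MvPolynomial ℕ K →ₐ[K] BiPoly K) =
          MvPolynomial.rename Sum.inr :=
        MvPolynomial.algHom_ext fun i => by rw [MvPolynomial.aeval_X, MvPolynomial.rename_X, g]
      rw [innerPart, h3, AlgHom.comp_apply]
    rw [h2, ← map_zero (MvPolynomial.rename (R := K) (Sum.inr : ℕ → ℕ ⊕ ℕ))] at h1
    exact MvPolynomial.rename_injective _ Sum.inr_injective h1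
  obtain ⟨x, hx, hx'⟩ := exists_linear_presentation J hc
  have h0 : Finsupp.linearCombination (BiPoly K) (vec (K := K)) x = 0 := by
    ext1 k
    have h := hx' (Pi.single k 1)
    rw [hf, linearCombination_pi_single_one] at h
    exact h
  rw [linearCombination_eq_zero (mulMap_koszul J) (mulMap_anti J) h0, map_zero] at hx
  exact ((squareIdeal J).quotientAlgHom_eq_zero_iff (K := K) _).1 hx.symm

end Linear

/-! ### The quadratic layer: products of two skew generators modulo `J` -/

section Quadratic

variable [CharZero K] {J : TwoSidedIdeal (StarPoly K)} (hJ : IsTStarIdeal K J)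
  (hB : ∀ f, IsBasic K f → f ∈ J)

/-- The map `v ↦ X * v * Y` for two generators `X` and `Y`, with values modulo `J`. -/
def mulMulMap (X Y : ℕ ⊕ (ℕ × ℕ)) : BiHom (J.quotientAlgHom (K := K)) :=
  .mk ((J.quotientAlgHom (K := K)).toLinearMap ∘ₗ LinearMap.mulRight K (skewGen Y) ∘ₗ
    LinearMap.mulLeft K (skewGen X)) (by
    intro x hx
    refine ⟨?_, fun v => ?_⟩
    · exact (J.quotientAlgHom_eq_zero_iff (K := K) _).2
        (commPart_ker_triple_mem hJ hB (commPart_skewGen X) hx (commPart_skewGen Y))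
    · change J.quotientAlgHom (K := K) x * J.quotientAlgHom (K := K) (skewGen X * v * skewGen Y) = 0
      rw [← map_mul, TwoSidedIdeal.quotientAlgHom_eq_zero_iff, ← mul_assoc]
      exact commPart_ker_triple_mem hJ hB hx (by rw [map_mul, commPart_skewGen, zero_mul])
        (commPart_skewGen Y))

theorem app_mulMulMap (X Y : ℕ ⊕ (ℕ × ℕ)) (v : StarPoly K) :
    app v (mulMulMap hJ hB X Y) = J.quotientAlgHom (K := K) (skewGen X * v * skewGen Y) := rfl

theorem mulMulMap_koszul (i j p : ℕ) (Y : ℕ ⊕ (ℕ × ℕ)) :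
    (t i : BiPoly K) • mulMulMap hJ hB (.inr (p, j)) Y -
      (t j : BiPoly K) • mulMulMap hJ hB (.inr (p, i)) Y =
    (t p : BiPoly K) • mulMulMap hJ hB (.inr (i, j)) Y := by
  refine BiHom.ext fun v => ?_
  rw [map_sub, app_t_smul, app_t_smul, app_t_smul]
  simp only [app_mulMulMap, ← map_mul, ← map_sub]
  congr 1
  generalize (skewGen Y : StarPoly K) = Z
  simp only [skewGen]
  noncomm_ring

theorem mulMulMap_anti (i j : ℕ) (Y : ℕ ⊕ (ℕ × ℕ)) :
    mulMulMap hJ hB (.inr (j, i)) Y = - mulMulMap hJ hB (.inr (i, j)) Y := by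
  refine BiHom.ext fun v => ?_
  rw [map_neg]
  simp only [app_mulMulMap, ← map_neg]
  congr 1
  generalize (skewGen Y : StarPoly K) = Z
  simp only [skewGen]
  noncomm_ring

theorem mulMulMap_symm (X Y : ℕ ⊕ (ℕ × ℕ)) : mulMulMap hJ hB X Y = mulMulMap hJ hB Y X := by
  refine BiHom.ext fun v => ?_
  rw [← sub_eq_zero, app_mulMulMap, app_mulMulMap, ← map_sub,
    TwoSidedIdeal.quotientAlgHom_eq_zero_iff]
  exact skew_mul_mul_skew_comm_mem hJ hB (isSkew_skewGen X) (isSkew_skewGen Y) v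

/-- The sixth basic polynomial gives the relation only at v = 1. The Plücker expression ω is
alternating in its first two indices, and t_m may be exchanged with its first index; a cycle of such
moves gives t_m ω = -t_m ω, hence t_m ω = 0. Thus ω at y_m v is y_m times ω at v, and vanishing
spreads from 1 to all v. -/
theorem mulMulMap_pluecker (i j k l : ℕ) :
    mulMulMap hJ hB (.inr (i, j)) (.inr (k, l)) - mulMulMap hJ hB (.inr (i, k)) (.inr (j, l)) +
      mulMulMap hJ hB (.inr (i, l)) (.inr (j, k)) = 0 := by
  let ω : ℕ → ℕ → ℕ → ℕ → BiHom (J.quotientAlgHom (K := K)) := fun i j k l =>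
    mulMulMap hJ hB (.inr (i, j)) (.inr (k, l)) - mulMulMap hJ hB (.inr (i, k)) (.inr (j, l)) +
      mulMulMap hJ hB (.inr (i, l)) (.inr (j, k))
  have kos := mulMulMap_koszul hJ hB
  have anti := mulMulMap_anti hJ hB
  have symm := mulMulMap_symm hJ hB
  have hswap : ∀ i j k l, ω j i k l = - ω i j k l := by
    intro i j k l
    simp only [ω]
    rw [anti i j, symm (.inr (j, k)) (.inr (i, l)), symm (.inr (j, l)) (.inr (i, k))]
    abel
  have hmove : ∀ m i j k l, (t m : BiPoly K) • ω i j k l = (t i : BiPoly K) • ω m j k l := by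
    intro m i j k l
    have e1 := kos i j m (.inr (k, l))
    have e2 := kos i k m (.inr (j, l))
    have e3 := kos i l m (.inr (j, k))
    have f1 := kos k l j (.inr (m, i))
    rw [symm (.inr (j, l)), symm (.inr (j, k)), symm (.inr (k, l))] at f1
    simp only [ω]
    linear_combination (norm := module) f1 - e1 + e2 - e3
  have htwo : ∀ m, (t m : BiPoly K) • ω i j k l = 0 := by
    intro m
    have h : (t m : BiPoly K) • ω i j k l = - ((t m : BiPoly K) • ω i j k l) := by
      conv_lhs => rw [hmove m i j k l, hswap j m k l, smul_neg, hmove i j m k l, hswap m i k l,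
        smul_neg, neg_neg, hmove j m i k l, hswap i j k l, smul_neg]
    rw [eq_neg_iff_add_eq_zero, ← two_smul K, smul_eq_zero] at h
    exact h.resolve_left two_ne_zero
  have hone : app 1 (ω i j k l) = 0 := by
    simp only [ω, map_sub, map_add, app_mulMulMap, mul_one]
    rw [← map_sub, ← map_add, TwoSidedIdeal.quotientAlgHom_eq_zero_iff]
    exact pluecker_mem hJ hB i j k l
  have happ : ∀ u v, app v (ω i j k l) = 0 → app (u * v) (ω i j k l) = 0 := by
    intro u
    induction u using StarPoly.induction with
    | hC r =>
      intro v hv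
      rw [← Algebra.smul_def, app_smul, hv, smul_zero]
    | hy m =>
      intro v hv
      have h := congrArg (app v) (htwo m)
      rw [app_t_smul, hv, mul_zero, map_zero, zero_sub, neg_eq_zero] at h
      exact h
    | hz m => exact fun v _ => app_eq_zero (by rw [map_mul, commPart_z, zero_mul]) _
    | hmul a b ha hb => exact fun v hv => by rw [mul_assoc]; exact ha _ (hb _ hv)
    | hadd a b ha hb => exact fun v hv => by rw [add_mul, app_add, ha v hv, hb v hv, add_zero]
  refine BiHom.ext fun v => ?_
  have h := happ v 1 hone
  rw [mul_one] at h
  rw [map_zero]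
  exact h

theorem exists_quadratic_presentation (hG : ∀ f ∈ J, ∀ w, generic w f = 0) {f : StarPoly K}
    (hf : f ∈ squareIdeal J) :
    ∃ x : (ℕ ⊕ (ℕ × ℕ)) × (ℕ ⊕ (ℕ × ℕ)) →₀ BiPoly K,
      app 1 (Finsupp.linearCombination (BiPoly K) (fun X => mulMulMap hJ hB X.1 X.2) x) =
        J.quotientAlgHom (K := K) f ∧
      ∀ w, pairing w w (Finsupp.linearCombination (BiPoly K) vecTwo x) =
        -2 * generic w f 0 2 := by
  let p : StarPoly K → Prop := fun f =>
    ∃ x : (ℕ ⊕ (ℕ × ℕ)) × (ℕ ⊕ (ℕ × ℕ)) →₀ BiPoly K,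
      app 1 (Finsupp.linearCombination (BiPoly K) (fun X => mulMulMap hJ hB X.1 X.2) x) =
        J.quotientAlgHom (K := K) f ∧
      ∀ w, pairing w w (Finsupp.linearCombination (BiPoly K) vecTwo x) =
        -2 * generic w f 0 2
  have hadd : ∀ a b, p a → p b → p (a + b) := by
    rintro a b ⟨x, hx, hx'⟩ ⟨y, hy, hy'⟩
    refine ⟨x + y, by rw [map_add, map_add, map_add, hx, hy], fun w => ?_⟩
    rw [map_add, map_add, map_add, hx', hy', Matrix.add_apply, mul_add]
  -- The part in J is presented by 0, since it vanishes generically as well as modulo J.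
  have hmem : ∀ a ∈ J, p a := by
    intro a ha
    refine ⟨0, ?_, fun w => ?_⟩
    · rw [map_zero, map_zero, (J.quotientAlgHom_eq_zero_iff (K := K) a).2 ha]
    · rw [map_zero, map_zero, hG a ha, Matrix.zero_apply, mul_zero]
  have hprod : ∀ u X m Y v, p (u * skewGen X * m * skewGen Y * v) := by
    intro u X m Y v
    -- X m Y is central modulo J, so v moves to the left and joins u. The factor -2 in `p` combines
    -- the two orders in `vecTwo` with the sign of the (1,2) entry of a skew matrix.
    refine ⟨Finsupp.single (X, Y) (outerPart (u * v) * innerPart m), ?_, fun w => ?_⟩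
    · rw [Finsupp.linearCombination_single, mul_smul, app_outerPart_smul, app_innerPart_smul,
        app_mulMulMap, ← map_mul, mul_one, ← sub_eq_zero, ← map_sub,
        TwoSidedIdeal.quotientAlgHom_eq_zero_iff]
      have h := J.neg_mem (J.mul_mem_left u _ (skew_mul_mul_skew_central_mem hJ hB
        (isSkew_skewGen X) (isSkew_skewGen Y) m v))
      convert h using 1
      noncomm_ring
    · rw [Finsupp.linearCombination_single, map_smul, vecTwo, map_add, pairing_outer,
        pairing_outer, generic_two_skewGen, smul_eq_mul, map_mul]
      ring
  have hsq : ∀ u a b v, commPart a = 0 → commPart b = 0 → p (u * (a * b) * v) := by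
    intro u a b v ha hb
    refine commPart_ker_induction (p := fun a => p (u * (a * b) * v))
      (fun a a' h h' => ?_) (fun u' X v' => ?_) ha
    · rw [add_mul, mul_add, add_mul]
      exact hadd _ _ h h'
    refine commPart_ker_induction (p := fun b => p (u * (u' * skewGen X * v' * b) * v))
      (fun a a' h h' => ?_) (fun u'' Y v'' => ?_) hb
    · rw [mul_add, mul_add, add_mul]
      exact hadd _ _ h h'
    · have h := hprod (u * u') X (v' * u'') Y (v'' * v)
      simpa only [mul_assoc] using h
  rw [squareIdeal, TwoSidedIdeal.mem_span_iff_mem_addSubgroup_closure] at hf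
  change p f
  induction hf using AddSubgroup.closure_induction with
  | mem x hx =>
    obtain ⟨_, ⟨u, -, s, hs, rfl⟩, v, -, rfl⟩ := hx
    rcases hs with ⟨a, b, ha, hb, rfl⟩ | hs
    · exact hsq u a b v ha hb
    · exact hmem _ (J.mul_mem_right _ _ (J.mul_mem_left _ _ hs))
  | zero => exact hmem 0 J.zero_mem
  | add a b _ _ ha hb => exact hadd a b ha hb
  | neg a _ ha =>
    obtain ⟨x, hx, hx'⟩ := ha
    refine ⟨-x, by rw [map_neg, map_neg, map_neg, hx], fun w => ?_⟩
    rw [map_neg, map_neg, map_neg, hx', Matrix.neg_apply, mul_neg]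

include hJ hB in
theorem mem_of_generic_eq_zero (hG : ∀ f ∈ J, ∀ w, generic w f = 0) {f : StarPoly K}
    (hf : ∀ w, generic w f = 0) : f ∈ J := by
  obtain ⟨x, hx, hx'⟩ := exists_quadratic_presentation hJ hB hG (mem_squareIdeal J hf)
  have h0 : Finsupp.linearCombination (BiPoly K) (vecTwo (K := K)) x = 0 := by
    refine eq_zero_of_pairing (linearCombination_vecTwo_symm x) fun w => ?_
    rw [hx', hf, Matrix.zero_apply, mul_zero]
  rw [linearCombination_two_eq_zero (mulMulMap_koszul hJ hB) (mulMulMap_anti hJ hB)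
    (mulMulMap_symm hJ hB) (mulMulMap_pluecker hJ hB) h0, map_zero] at hx
  exact (J.quotientAlgHom_eq_zero_iff (K := K) _).1 hx.symm

end Quadratic

end

end StarPoly

theorem mainTheorem5 (K : Type*) [Field K] [CharZero K] :
    (StarPoly.tStarIdealSpan K {f | StarPoly.IsBasic K f} : Set (StarPoly K)) =
      StarPoly.identities K (invA K) := by
  have hle : ∀ f ∈ StarPoly.tStarIdealSpan K {f | StarPoly.IsBasic K f},
      f ∈ StarPoly.identities K (invA K) := fun f hf =>
    (StarPoly.mem_identitiesIdeal _ _).1 (StarPoly.tStarIdealSpan_le_identitiesIdeal hf)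
  refine Set.Subset.antisymm hle fun f hf => ?_
  exact StarPoly.mem_of_generic_eq_zero (StarPoly.isTStarIdeal_tStarIdealSpan _)
    (fun g hg => StarPoly.subset_tStarIdealSpan _ hg)
    (fun g hg w => StarPoly.generic_eq_zero w (hle g hg))
    (fun w => StarPoly.generic_eq_zero w hf)
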